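/- Fix an integer $N \ge 3$ and consider the following process of $N$ particles in $[0,1]$. For points $x_1,\dots,x_N \in [0,1]$ with barycentre $\mu = \frac1N\sum_i x_i$, let $\mathrm{ord}(x_1,\dots,x_N) = (x_{(1)},\dots,x_{(N)})$ be a rearrangement with $|x_{(1)}-\mu| \le \dots \le |x_{(N)}-\mu|$ (ties are broken in an arbitrary way, e.g. at random). The initial configuration $\mathcal X_N(0) = (X_{(1)}(0),\dots,X_{(N)}(0))$ is the ordered vector of $N$ (possibly random) points of $[0,1]$ that are almost surely distinct, and, for $t = 0,1,2,\dots$, $\mathcal X_N(t+1) = \mathrm{ord}(X_{(1)}(t),\dots,X_{(N-1)}(t),U_{t+1})$, where $U_{t+1}$ is uniform on $[0,1]$ and independent of $(\mathcal X_N(0),\dots,\mathcal X_N(t))$. There is a random variable $\xi_N \in [0,1]$ (unique up to null sets) such that almost surely $X_{(i)}(t) \to \xi_N$ as $t\to\infty$ for every $i \in \{1,\dots,N-1\}$. It has the following properties. (1) For $\rho \in (0,1)$ let $S_\rho$ be the event that $|X_{(i)}(0) - X_{(j)}(0)| \ge \rho$ for all $0 \le i < j \le N+1$, with the conventions $X_{(0)}(0)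 := 0$ and $X_{(N+1)}(0) := 1$. Then, for every $\rho \in (0,1)$ and every interval $I \subseteq [0,1]$ of positive length, there is $\delta > 0$, depending only on $N$, $I$ and $\rho$, such that $$\mathbb P[\xi_N \in I \mid \mathcal X_N(0)] \ge \delta\, \mathbf 1(S_\rho) \quad \text{a.s.}$$ (2) In particular, if $\mathcal X_N(0)$ is the ordered vector of $N$ independent uniform points of $[0,1]$, then $\mathbb P[\xi_N \in I] > 0$ for every interval $I \subseteq [0,1]$ of positive length; hence the support of the law of $\xi_N$ is $[0,1]$. -/

import Mathlib

open MeasureTheory ProbabilityTheory Filter Topology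

namespace BeautyContest

noncomputable section

/-- The barycentre `N⁻¹ ∑ xᵢ` of `N` points on the line. -/
def barycentre {N : ℕ} (x : Fin N → ℝ) : ℝ := (N : ℝ)⁻¹ * ∑ i, x i

/-- `y` is a vector of barycentric order statistics of `x`: a rearrangement of `x` in which the
distances to the common barycentre are nondecreasing. When there are ties, `x` has several such
rearrangements, and any of them is accepted. -/
def IsBarycentricOrder {N : ℕ} (x y : Fin N → ℝ) : Prop :=
  (∃ σ : Equiv.Perm (Fin N), y = x ∘ σ) ∧ Monotone fun i => |y i - barycentre y|

/-- `(x₁, …, x_{N-1}, u)`: the last entry of `x` is replaced by `u`. -/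
def replaceLast {N : ℕ} (x : Fin N → ℝ) (u : ℝ) : Fin N → ℝ :=
  fun i => if (i : ℕ) + 1 = N then u else x i

/-- The process with `N` particles in `[0,1]`: `X t ω` is the barycentrically ordered configuration
at time `t`, whose last entry is the extreme point, and `U (t + 1)` is the particle that replaces
this extreme point at time `t + 1`; it is uniform on `[0,1]` and independent of
`(X 0, …, X t)`. The variable `U 0` plays no role. The way in which ties are broken
(possibly with the help of extra randomness) is left free. -/
structure IsProcess {N : ℕ} {Ω : Type*} [MeasurableSpace Ω] (P : Measure Ω)
    (X : ℕ → Ω → Fin N → ℝ) (U : ℕ → Ω → ℝ) : Prop where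
  measurable_config : ∀ t, Measurable (X t)
  measurable_arrival : ∀ t, Measurable (U (t + 1))
  initial_mem : ∀ᵐ ω ∂P, ∀ i, X 0 ω i ∈ Set.Icc (0 : ℝ) 1
  initial_distinct : ∀ᵐ ω ∂P, Function.Injective (X 0 ω)
  initial_ordered : ∀ᵐ ω ∂P, IsBarycentricOrder (X 0 ω) (X 0 ω)
  arrival_law : ∀ t, P.map (U (t + 1)) = volume.restrict (Set.Icc (0 : ℝ) 1)
  arrival_indep : ∀ t, IndepFun (U (t + 1)) (fun ω (s : Fin (t + 1)) => X s ω) P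
  step : ∀ t, ∀ᵐ ω ∂P,
    IsBarycentricOrder (replaceLast (X t ω) (U (t + 1) ω)) (X (t + 1) ω)

/-- `ξ` is the random limit of the core: almost surely, each of the first `N - 1` entries of the
ordered configuration converges to `ξ`. -/
def IsCoreLimit {N : ℕ} {Ω : Type*} [MeasurableSpace Ω] (P : Measure Ω)
    (X : ℕ → Ω → Fin N → ℝ) (ξ : Ω → ℝ) : Prop :=
  Measurable ξ ∧
    ∀ᵐ ω ∂P, ∀ i : Fin N, (i : ℕ) + 1 < N → Tendsto (fun t => X t ω i) atTop (𝓝 (ξ ω))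

/-- The points `0, x₁, …, x_N, 1`. -/
def withEndpoints {N : ℕ} (x : Fin N → ℝ) : Fin (N + 2) → ℝ :=
  Fin.cons 0 (Fin.snoc x 1 : Fin (N + 1) → ℝ)

/-- The minimal distance between two of the points `0, x₁, …, x_N, 1` with different indices. -/
def minSpacing {N : ℕ} (x : Fin N → ℝ) : ℝ :=
  ⨅ p : {p : Fin (N + 2) × Fin (N + 2) // p.1 ≠ p.2},
    |withEndpoints x p.1.1 - withEndpoints x p.1.2|

/-- The event that the initial points are `ρ`-separated from each other and from `0` and `1`. -/
def separated {N : ℕ} {Ω : Type*} (X : ℕ → Ω → Fin N → ℝ) (ρ : ℝ) : Set Ω :=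
  {ω | ρ ≤ minSpacing (X 0 ω)}

/-- The initial configuration is the ordered vector of `N` independent uniform points. -/
def IsUniformStart {N : ℕ} {Ω : Type*} [MeasurableSpace Ω] (P : Measure Ω)
    (X : ℕ → Ω → Fin N → ℝ) : Prop :=
  ∃ Y : Fin N → Ω → ℝ, (∀ i, Measurable (Y i)) ∧ iIndepFun Y P ∧
    (∀ i, P.map (Y i) = volume.restrict (Set.Icc (0 : ℝ) 1)) ∧
    ∀ᵐ ω ∂P, IsBarycentricOrder (fun i => Y i ω) (X 0 ω)

end

end BeautyContest

/-!
Write `N = n + 1`, and call the first `n` points of the ordered configuration the core, with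
barycentre `b` and spread `R`, the square root of the sum of the squared distances of the core
points to `b`. In one step a new point joins the core, and the point farthest from the barycentre of
these `N` points leaves.

*Convergence.* Removing the farthest point minimises the inertia of the remaining ones, so `R` never
increases. If the arrival falls within `R / (4n)` of `b`, which has probability at least `R / (4n)`,
then `R` drops by at least `R / (8n)`; see `coreSpread_step_le_of_near`. The barycentre `b` moves
only if the arrival falls within `3R` of it, and then by at most `2R`; see `coreMean_step_le`. So
the expected move of `b` and the expected decrease of `R` in one step are both of the order `R ^ 2`,
and the expected length of the whole path of `b` after time `T` is at most a constant times the
expectation of `R` at time `T`, on every event of the past (`IsProcess.lintegral_tsum_edist`). This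
gives the existence of the limit. By Markov's inequality it also gives that, once the core is
concentrated near a point, the limit is near that point with probability at least one half
(`IsProcess.half_le_measure_limit_near`).

*Steering.* It remains to bring the core close to a given point with a probability that is bounded
below. Let `p` lie in a gap of the core with at most half of the `N` points on either side. Arrivals
very close to `p` never leave before all of the original core points have left, because those on the
far side are outweighed; after `n` arrivals the core consists of these arrivals (`gather`). Now let
the arrivals follow a monotone sequence with decreasing increments. The barycentre of `n + 1`
consecutive points of such a sequence lies beyond their midrange, so the oldest point is the one
that leaves (`travel`). A quadratic sequence from `p` to the target `a` with sufficiently many steps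
does both, its first `n` points being close to `p` and its last `n` points close to `a` (`steer`). A
small perturbation of the arrivals does no harm, so the probability of this scenario is at least a
product of lengths of intervals, which depends on `p` and `a` only. A separated configuration has
such a gap around one of finitely many grid points `p` (`exists_hasMedianGap`), which makes the
bound uniform.
-/

open MeasureTheory ProbabilityTheory Filter Topology
open scoped ENNReal

namespace BeautyContest

noncomputable section

variable {n : ℕ}

/-! ### The core and its dynamics -/

/-- The core of a configuration of `n + 1` particles: all of its points but the last one. -/
def core {n : ℕ} (x : Fin (n + 1) → ℝ) : Fin n → ℝ := fun i => x i.castSucc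

/-- The points of the core as a multiset, so that the order is forgotten. -/
def coreMultiset {n : ℕ} (x : Fin (n + 1) → ℝ) : Multiset ℝ := Finset.univ.val.map (core x)

/-- The barycentre of the core. -/
def coreMean {n : ℕ} (x : Fin (n + 1) → ℝ) : ℝ := (∑ i, core x i) / n

/-- The sum of the squared distances of the core points to their barycentre. -/
def coreInertia {n : ℕ} (x : Fin (n + 1) → ℝ) : ℝ := ∑ i, (core x i - coreMean x) ^ 2

/-- The Lyapunov function of the process: the square root of the inertia of the core. -/
def coreSpread {n : ℕ} (x : Fin (n + 1) → ℝ) : ℝ := √(coreInertia x)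

/-- One step of the process, seen on the core: `u` joins the points of `c`, and a point farthest
from the barycentre of all these points is removed, which leaves `c'`. -/
def CoreStep (c : Multiset ℝ) (u : ℝ) (c' : Multiset ℝ) : Prop :=
  ∃ e, u ::ₘ c = e ::ₘ c' ∧
    ∀ w ∈ u ::ₘ c, |w - (u + c.sum) / (c.card + 1)| ≤ |e - (u + c.sum) / (c.card + 1)|

lemma replaceLast_eq_snoc (x : Fin (n + 1) → ℝ) (u : ℝ) :
    replaceLast x u = Fin.snoc (α := fun _ => ℝ) (core x) u := by
  funext i
  refine Fin.lastCases ?_ (fun j => ?_) i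
  · simp [replaceLast]
  · have := j.2.ne
    simp [replaceLast, core, this]

lemma map_univ_eq_cons (y : Fin (n + 1) → ℝ) :
    (Finset.univ.val.map y : Multiset ℝ) = y (Fin.last n) ::ₘ coreMultiset y := by
  rw [Fin.univ_castSuccEmb]
  simp only [Finset.cons_val, Multiset.map_cons, Finset.map_val, Multiset.map_map, coreMultiset]
  rfl

@[simp] lemma card_coreMultiset (x : Fin (n + 1) → ℝ) : (coreMultiset x).card = n := by
  simp [coreMultiset]

lemma mem_coreMultiset {x : Fin (n + 1) → ℝ} {a : ℝ} :
    a ∈ coreMultiset x ↔ ∃ i, core x i = a := by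
  simp [coreMultiset]

lemma sum_coreMultiset (x : Fin (n + 1) → ℝ) : (coreMultiset x).sum = ∑ i, core x i := rfl

lemma coreStep_of_isBarycentricOrder {x y : Fin (n + 1) → ℝ} {u : ℝ}
    (h : IsBarycentricOrder (replaceLast x u) y) :
    CoreStep (coreMultiset x) u (coreMultiset y) := by
  obtain ⟨⟨σ, hσ⟩, hm⟩ := h
  have key : u ::ₘ coreMultiset x = y (Fin.last n) ::ₘ coreMultiset y := by
    rw [← map_univ_eq_cons y, hσ, ← Multiset.map_map,
      show (Finset.univ.val.map σ : Multiset (Fin (n + 1))) = Finset.univ.val from by simp,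
      map_univ_eq_cons, replaceLast_eq_snoc]
    congr 1
    · simp
    · have hc : core (Fin.snoc (α := fun _ => ℝ) (core x) u) = core x := by
        funext i
        simp [core]
      exact (congrArg (fun f => Finset.univ.val.map f) hc).symm
  refine ⟨y (Fin.last n), key, fun w hw => ?_⟩
  have hb : (u + (coreMultiset x).sum) / ((coreMultiset x).card + 1) = barycentre y := by
    rw [← Multiset.sum_cons, key, ← map_univ_eq_cons, barycentre, card_coreMultiset]
    push_cast
    rw [inv_mul_eq_div]
    rfl
  rw [hb]
  rw [key, ← map_univ_eq_cons] at hw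
  obtain ⟨i, -, rfl⟩ := Multiset.mem_map.1 hw
  exact hm (Fin.le_last i)

/-! ### The spread of the core as a Lyapunov function -/

lemma coreInertia_eq (hn : n ≠ 0) (x : Fin (n + 1) → ℝ) :
    coreInertia x = ∑ i, core x i ^ 2 - (∑ i, core x i) ^ 2 / n := by
  have hn' : (n : ℝ) ≠ 0 := by exact_mod_cast hn
  simp only [coreInertia, sub_sq, Finset.sum_add_distrib, Finset.sum_sub_distrib, ← Finset.sum_mul,
    ← Finset.mul_sum, Finset.sum_const, Finset.card_univ, Fintype.card_fin, nsmul_eq_mul, coreMean]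
  field_simp
  ring

lemma coreInertia_nonneg (x : Fin (n + 1) → ℝ) : 0 ≤ coreInertia x :=
  Finset.sum_nonneg fun _ _ => sq_nonneg _

lemma coreSpread_nonneg (x : Fin (n + 1) → ℝ) : 0 ≤ coreSpread x := Real.sqrt_nonneg _

lemma sq_coreSpread (x : Fin (n + 1) → ℝ) : coreSpread x ^ 2 = coreInertia x :=
  Real.sq_sqrt (coreInertia_nonneg x)

lemma abs_core_sub_coreMean_le (x : Fin (n + 1) → ℝ) (i : Fin n) :
    |core x i - coreMean x| ≤ coreSpread x :=
  Real.abs_le_sqrt (Finset.single_le_sum (f := fun i => (core x i - coreMean x) ^ 2)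
    (fun _ _ => sq_nonneg _) (Finset.mem_univ i))

lemma exists_coreInertia_le (hn : n ≠ 0) (x : Fin (n + 1) → ℝ) :
    ∃ i, coreInertia x / n ≤ (core x i - coreMean x) ^ 2 := by
  have : NeZero n := ⟨hn⟩
  have hn' : (0 : ℝ) < n := by exact_mod_cast Nat.pos_of_ne_zero hn
  by_contra! hlt
  have := Finset.sum_lt_sum_of_nonempty (s := Finset.univ) (Finset.univ_nonempty)
    (fun i _ => hlt i)
  simp only [Finset.sum_const, Finset.card_univ, Fintype.card_fin, nsmul_eq_mul] at this
  rw [mul_div_cancel₀ _ hn'.ne'] at this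
  exact lt_irrefl _ this

lemma coreMean_mem_Icc (hn : n ≠ 0) {x : Fin (n + 1) → ℝ} {a b : ℝ}
    (h : ∀ i, core x i ∈ Set.Icc a b) : coreMean x ∈ Set.Icc a b := by
  have hn' : (0 : ℝ) < n := by exact_mod_cast Nat.pos_of_ne_zero hn
  have h1 := Finset.card_nsmul_le_sum Finset.univ (core x) a (fun i _ => (h i).1)
  have h2 := Finset.sum_le_card_nsmul Finset.univ (core x) b (fun i _ => (h i).2)
  simp only [Finset.card_univ, Fintype.card_fin, nsmul_eq_mul] at h1 h2
  constructor
  · rw [coreMean, le_div_iff₀ hn']; linarith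
  · rw [coreMean, div_le_iff₀ hn']; linarith

lemma coreSpread_le (hn : n ≠ 0) {x : Fin (n + 1) → ℝ} {a b : ℝ}
    (h : ∀ i, core x i ∈ Set.Icc a b) : coreSpread x ≤ n * (b - a) := by
  have hn' : (1 : ℝ) ≤ n := by exact_mod_cast Nat.one_le_iff_ne_zero.2 hn
  have hm := coreMean_mem_Icc hn h
  have hab : 0 ≤ b - a := by linarith [hm.1, hm.2]
  apply Real.sqrt_le_iff.2 ⟨by positivity, ?_⟩
  calc coreInertia x ≤ ∑ i : Fin n, (b - a) ^ 2 := by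
        refine Finset.sum_le_sum fun i _ => sq_le_sq' ?_ ?_ <;>
          linarith [(h i).1, (h i).2, hm.1, hm.2]
    _ = n * (b - a) ^ 2 := by simp
    _ ≤ (n * (b - a)) ^ 2 := by
        rw [mul_pow]
        exact mul_le_mul_of_nonneg_right (by nlinarith) (sq_nonneg _)

/-- Removing a point `e` from `n + 1` points lowers their inertia by `(n + 1) / n` times the squared
distance of `e` to their barycentre. -/
lemma coreInertia_step (hn : n ≠ 0) {x y : Fin (n + 1) → ℝ} {u e : ℝ}
    (h : u ::ₘ coreMultiset x = e ::ₘ coreMultiset y) :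
    coreInertia y = coreInertia x + n / (n + 1) * (u - coreMean x) ^ 2
      - (n + 1) / n * (e - (u + ∑ i, core x i) / (n + 1)) ^ 2 := by
  have hn' : (n : ℝ) ≠ 0 := by exact_mod_cast hn
  have hn1 : (n : ℝ) + 1 ≠ 0 := by positivity
  have h1 := congrArg Multiset.sum h
  have h2 := congrArg (fun s => (Multiset.map (fun a : ℝ => a ^ 2) s).sum) h
  simp only [Multiset.sum_cons, sum_coreMultiset, Multiset.map_cons] at h1 h2
  simp only [coreMultiset, Multiset.map_map, Function.comp_def] at h2
  change u ^ 2 + ∑ i, core x i ^ 2 = e ^ 2 + ∑ i, core y i ^ 2 at h2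
  rw [coreInertia_eq hn, coreInertia_eq hn, coreMean]
  obtain ⟨p, hp⟩ : ∃ p, p = ∑ i, core x i := ⟨_, rfl⟩
  have h1' : ∑ i, core y i = u + p - e := by rw [hp]; linarith
  have h2' : ∑ i, core y i ^ 2 = u ^ 2 + ∑ i, core x i ^ 2 - e ^ 2 := by linarith
  rw [h1', h2', ← hp]
  field_simp
  ring

lemma coreMean_step {x y : Fin (n + 1) → ℝ} {u e : ℝ}
    (h : u ::ₘ coreMultiset x = e ::ₘ coreMultiset y) :
    coreMean y - coreMean x = (u - e) / n := by
  have h1 := congrArg Multiset.sum h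
  simp only [Multiset.sum_cons, sum_coreMultiset] at h1
  rw [coreMean, coreMean, ← sub_div]
  congr 1
  linarith

/-- The Lyapunov function never increases: removing the farthest point is at least as good as
removing the new one. -/
lemma coreSpread_step_le (hn : n ≠ 0) {x y : Fin (n + 1) → ℝ} {u : ℝ}
    (h : CoreStep (coreMultiset x) u (coreMultiset y)) : coreSpread y ≤ coreSpread x := by
  obtain ⟨e, he, hfar⟩ := h
  have hn' : (0 : ℝ) < n := by exact_mod_cast Nat.pos_of_ne_zero hn
  have hu := hfar u (Multiset.mem_cons_self u _)
  rw [sum_coreMultiset, card_coreMultiset] at hu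
  apply Real.sqrt_le_sqrt
  rw [coreInertia_step hn he]
  have h2 := mul_le_mul_of_nonneg_left (sq_le_sq.2 hu) (show 0 ≤ ((n : ℝ) + 1) / n by positivity)
  have h3 : ((n : ℝ) + 1) / n * (u - (u + ∑ i, core x i) / (n + 1)) ^ 2
      = n / (n + 1) * (u - coreMean x) ^ 2 := by
    rw [coreMean]; field_simp; ring
  linarith

/-- If the new point falls close to the barycentre of the core, then the Lyapunov function drops by
a fixed proportion. -/
lemma coreSpread_step_le_of_near (hn : n ≠ 0) {x y : Fin (n + 1) → ℝ} {u : ℝ}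
    (h : CoreStep (coreMultiset x) u (coreMultiset y))
    (hu : |u - coreMean x| ≤ coreSpread x / (4 * n)) :
    coreSpread y + coreSpread x / (8 * n) ≤ coreSpread x := by
  obtain ⟨e, he, hfar⟩ := h
  have hn' : (1 : ℝ) ≤ n := by exact_mod_cast Nat.one_le_iff_ne_zero.2 hn
  have hn0 : (0 : ℝ) < n := by linarith
  obtain ⟨i, hi⟩ := exists_coreInertia_le hn x
  have hi2 := hfar (core x i) (Multiset.mem_cons_of_mem (mem_coreMultiset.2 ⟨i, rfl⟩))
  rw [sum_coreMultiset, card_coreMultiset] at hi2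
  have hi3 := mul_le_mul_of_nonneg_left (sq_le_sq.2 hi2)
    (show 0 ≤ ((n : ℝ) + 1) / n by positivity)
  have hS := coreInertia_step hn he
  have hR := coreSpread_nonneg x
  rw [← sq_coreSpread x] at hS hi
  set R := coreSpread x
  set v := u - coreMean x with hv
  set a := core x i - coreMean x with ha
  have hm : core x i - (u + ∑ i, core x i) / (n + 1) = a - v / (n + 1) := by
    rw [ha, hv, coreMean]; field_simp; ring
  rw [hm] at hi3
  have hv2 : v ^ 2 ≤ R ^ 2 / (16 * n) := by
    have : v ^ 2 ≤ (R / (4 * n)) ^ 2 := sq_le_sq' (by linarith [abs_le.1 hu]) (abs_le.1 hu).2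
    refine this.trans ?_
    rw [div_pow]
    gcongr
    nlinarith
  have hw2 : (v / (n + 1)) ^ 2 ≤ v ^ 2 := by
    rw [div_pow]
    exact div_le_self (sq_nonneg _) (by nlinarith)
  have h1 : R ^ 2 / (2 * n) - v ^ 2 ≤ (a - v / (n + 1)) ^ 2 := by
    have : R ^ 2 / (2 * n) = R ^ 2 / n / 2 := by field_simp
    nlinarith [sq_nonneg (a - 2 * (v / (n + 1)))]
  have h0 : 0 ≤ R ^ 2 / (2 * n) - v ^ 2 := by
    have : R ^ 2 / (2 * n) = 8 * (R ^ 2 / (16 * n)) := by field_simp; ring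
    have : 0 ≤ R ^ 2 / (16 * n) := by positivity
    linarith
  have h2 : R ^ 2 / (2 * n) - v ^ 2 ≤ ((n : ℝ) + 1) / n * (a - v / (n + 1)) ^ 2 := by
    refine h1.trans (le_mul_of_one_le_left (sq_nonneg _) ?_)
    rw [le_div_iff₀ hn0]; linarith
  have h3 : (n : ℝ) / (n + 1) * v ^ 2 ≤ v ^ 2 :=
    mul_le_of_le_one_left (sq_nonneg _) (by rw [div_le_one (by positivity)]; linarith)
  have h4 : coreInertia y ≤ R ^ 2 - R ^ 2 / (4 * n) := by
    have e1 : R ^ 2 / (2 * n) = 8 * (R ^ 2 / (16 * n)) := by field_simp; ring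
    have e2 : R ^ 2 / (4 * n) = 4 * (R ^ 2 / (16 * n)) := by field_simp; ring
    have : 0 ≤ R ^ 2 / (16 * n) := by positivity
    linarith
  have h5 : coreSpread y ≤ R - R / (8 * n) := by
    have h8 : R / (8 * n) ≤ R := div_le_self hR (by linarith)
    refine Real.sqrt_le_iff.2 ⟨by linarith, h4.trans ?_⟩
    have : R ^ 2 / (4 * n) = 2 * R * (R / (8 * n)) := by field_simp; ring
    nlinarith [sq_nonneg (R / (8 * n))]
  linarith

/-- The core can only move when the new point falls near it, and then it moves by at most a multiple
of its spread. -/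
lemma coreMean_step_le (hn : 2 ≤ n) {x y : Fin (n + 1) → ℝ} {u : ℝ}
    (h : CoreStep (coreMultiset x) u (coreMultiset y)) :
    coreMean y = coreMean x ∨
      (|u - coreMean x| ≤ 3 * coreSpread x ∧ |coreMean y - coreMean x| ≤ 2 * coreSpread x) := by
  obtain ⟨e, he, hfar⟩ := h
  have hn2 : (2 : ℝ) ≤ n := by exact_mod_cast hn
  have hb := coreMean_step he
  by_cases hue : e = u
  · left
    rw [hue, sub_self, zero_div] at hb
    linarith
  right
  have hmem : e ∈ u ::ₘ coreMultiset x := he ▸ Multiset.mem_cons_self e _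
  obtain ⟨i, hi⟩ := mem_coreMultiset.1 ((Multiset.mem_cons.1 hmem).resolve_left hue)
  have hd := abs_core_sub_coreMean_le x i
  rw [hi] at hd
  have hu := hfar u (Multiset.mem_cons_self u _)
  rw [sum_coreMultiset, card_coreMultiset] at hu
  set R := coreSpread x
  set v := u - coreMean x with hv
  set a := e - coreMean x with ha
  have hm1 : e - (u + ∑ i, core x i) / (n + 1) = a - v / (n + 1) := by
    rw [ha, hv, coreMean]; field_simp; ring
  have hm2 : u - (u + ∑ i, core x i) / (n + 1) = v - v / (n + 1) := by
    rw [hv, coreMean]; field_simp; ring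
  rw [hm1, hm2] at hu
  have hk : |v / (n + 1)| ≤ |v| / 3 := by
    rw [abs_div, abs_of_pos (show (0 : ℝ) < n + 1 by linarith)]
    exact div_le_div_of_nonneg_left (abs_nonneg _) (by norm_num) (by linarith)
  have hv3 : |v| ≤ 3 * R := by
    have h1 := abs_sub_abs_le_abs_sub v (v / (n + 1))
    have h2 := abs_sub a (v / (n + 1))
    linarith
  refine ⟨hv3, ?_⟩
  have hva : |u - e| ≤ 4 * R := by
    have : u - e = v - a := by rw [hv, ha]; ring
    rw [this]
    linarith [abs_sub v a]
  rw [hb, abs_div, abs_of_pos (show (0 : ℝ) < n by linarith), div_le_iff₀ (by linarith)]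
  have := coreSpread_nonneg x
  nlinarith

/-! ### Gathering the core in a median gap -/

/-- A cluster `s` near `p` outweighs at most half of all points if these lie to its right: the
farthest point from the barycentre is not in `s`. When exactly half of the points lie to the right,
this uses that they do not all coincide. -/
lemma exists_farther_of_right (hn : 2 ≤ n) {s r : Multiset ℝ} {p η ρ : ℝ}
    (hη : 3 * (n + 1) * η < ρ) (hcard : s.card + r.card = n + 1)
    (hs : ∀ x ∈ s, |x - p| ≤ η) (hr : ∀ x ∈ r, p + ρ ≤ x) (hr0 : r ≠ 0) (hnd : r.Nodup)
    (hsep : ∀ x ∈ r, ∀ y ∈ r, x ≠ y → ρ ≤ |x - y|) (h2 : 2 * r.card ≤ n + 1)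
    {e : ℝ} (he : e ∈ s) :
    ∃ w ∈ r, |e - (s.sum + r.sum) / (n + 1)| < |w - (s.sum + r.sum) / (n + 1)| := by
  have hn2 : (2 : ℝ) ≤ n := by exact_mod_cast hn
  have hη0 : 0 ≤ η := (abs_nonneg _).trans (hs e he)
  have hρ : η < ρ := by nlinarith
  obtain ⟨R, hR, hmax⟩ := r.toFinset.exists_max_image id
    (by simpa [Multiset.toFinset_nonempty] using hr0)
  simp only [Multiset.mem_toFinset, id] at hR hmax
  refine ⟨R, hR, ?_⟩
  have hs1 : s.sum ≤ s.card * (p + η) := by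
    have := Multiset.sum_le_card_nsmul s (p + η) fun x hx => by linarith [(abs_le.1 (hs x hx)).2]
    rwa [nsmul_eq_mul] at this
  have hr1 : r.sum ≤ r.card * R := by
    simpa using Multiset.sum_le_card_nsmul r R hmax
  -- a second point of `r` is below `R` by at least `ρ`
  have hr2 : 2 ≤ r.card → r.sum ≤ r.card * R - ρ := by
    intro h
    obtain ⟨r', rfl⟩ := Multiset.exists_cons_of_mem hR
    have : r' ≠ 0 := by rintro rfl; simp at h
    obtain ⟨w, hw⟩ := Multiset.exists_mem_of_ne_zero this
    obtain ⟨r'', rfl⟩ := Multiset.exists_cons_of_mem hw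
    have hne : R ≠ w := by rintro rfl; simp at hnd
    have h1 := hsep R hR w (by simp) hne
    have h3 := hmax w (by simp)
    rw [abs_of_nonneg (by linarith)] at h1
    have h4 := Multiset.sum_le_card_nsmul r'' R fun x hx => hmax x (by simp [hx])
    simp only [Multiset.sum_cons, Multiset.card_cons, nsmul_eq_mul] at h4 ⊢
    push_cast
    linarith
  have hRp := hr R hR
  have he1 := abs_le.1 (hs e he)
  have hc : (s.card : ℝ) + r.card = n + 1 := by exact_mod_cast hcard
  have key : 2 * (s.sum + r.sum) < (n + 1) * (R + e) := by
    have hk0 : (0 : ℝ) ≤ r.card := by positivity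
    have h5 : ((n : ℝ) + 1) * (R + (p - η)) ≤ (n + 1) * (R + e) := by
      apply mul_le_mul_of_nonneg_left <;> linarith
    refine lt_of_lt_of_le ?_ h5
    have h6 : (3 * (s.card : ℝ) + r.card) * η ≤ 3 * (n + 1) * η :=
      mul_le_mul_of_nonneg_right (by linarith) hη0
    -- either `s` has a strict majority, or the two parts have the same size, which is at least `2`
    -- because `n + 1 ≥ 3`
    rcases (by omega : r.card + 1 ≤ s.card ∨ (s.card = r.card ∧ 2 ≤ r.card)) with h | ⟨h, h'⟩
    · have h7 : (r.card : ℝ) + 1 ≤ s.card := by exact_mod_cast h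
      have h8 : (R - p) ≤ ((s.card : ℝ) - r.card) * (R - p) :=
        le_mul_of_one_le_left (by linarith) (by linarith)
      rw [← hc]
      linarith
    · have h9 := hr2 h'
      rw [h] at hs1 h6
      rw [← hc, h]
      linarith
  have hm : 2 * ((s.sum + r.sum) / (n + 1)) < R + e := by
    rw [← mul_div_assoc, div_lt_iff₀ (by linarith)]
    linarith
  refine lt_of_lt_of_le ?_ (le_abs_self _)
  rw [abs_lt]
  constructor <;> linarith

/-- As long as points `r` away from the cluster `s` are left, at most half of all points on each
side, the farthest point from the barycentre is one of them. -/
lemma exists_farther (hn : 2 ≤ n) {s r : Multiset ℝ} {p η ρ : ℝ}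
    (hη : 3 * (n + 1) * η < ρ) (hcard : s.card + r.card = n + 1)
    (hs : ∀ x ∈ s, |x - p| ≤ η) (hr : ∀ x ∈ r, ρ ≤ |x - p|) (hr0 : r ≠ 0) (hnd : r.Nodup)
    (hsep : ∀ x ∈ r, ∀ y ∈ r, x ≠ y → ρ ≤ |x - y|)
    (hright : 2 * (r.filter (p < ·)).card ≤ n + 1) (hleft : 2 * (r.filter (· < p)).card ≤ n + 1)
    {e : ℝ} (he : e ∈ s) :
    ∃ w ∈ r, |e - (s.sum + r.sum) / (n + 1)| < |w - (s.sum + r.sum) / (n + 1)| := by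
  have hη0 : 0 ≤ η := (abs_nonneg _).trans (hs e he)
  have hρ : η < ρ := by nlinarith [(Nat.cast_nonneg n : (0 : ℝ) ≤ n)]
  have he1 := abs_le.1 (hs e he)
  by_cases hR : ∀ x ∈ r, p < x
  · refine exists_farther_of_right hn hη hcard hs (fun x hx => ?_) hr0 hnd hsep ?_ he
    · have := hr x hx
      rw [abs_of_pos (by linarith [hR x hx])] at this
      linarith
    · rwa [Multiset.filter_eq_self.2 hR] at hright
  by_cases hL : ∀ x ∈ r, x < p
  · -- the reflection at the origin swaps left and right
    obtain ⟨w, hw, hlt⟩ := exists_farther_of_right (s := s.map Neg.neg) (r := r.map Neg.neg)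
      (p := -p) (e := -e) hn hη (by simpa using hcard)
      (by
        simp only [Multiset.mem_map, forall_exists_index, and_imp, forall_apply_eq_imp_iff₂]
        intro x hx
        rw [show -x - -p = -(x - p) by ring, abs_neg]
        exact hs x hx)
      (by
        simp only [Multiset.mem_map, forall_exists_index, and_imp, forall_apply_eq_imp_iff₂]
        intro x hx
        have := hr x hx
        rw [abs_of_neg (by linarith [hL x hx])] at this
        linarith)
      (by simpa using hr0) (hnd.map neg_injective)
      (by
        simp only [Multiset.mem_map, forall_exists_index, and_imp, forall_apply_eq_imp_iff₂]
        intro x hx y hy hxy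
        rw [show -x - -y = -(x - y) by ring, abs_neg]
        exact hsep x hx y hy (by simpa using hxy))
      (by
        rw [Multiset.card_map]
        rwa [Multiset.filter_eq_self.2 hL] at hleft)
      (Multiset.mem_map_of_mem _ he)
    obtain ⟨w, hw', rfl⟩ := Multiset.mem_map.1 hw
    refine ⟨w, hw', ?_⟩
    rw [Multiset.sum_map_neg', Multiset.sum_map_neg', ← neg_add, neg_div] at hlt
    rwa [show ∀ a b : ℝ, -a - -b = -(a - b) by intros; ring, abs_neg,
      show ∀ a b : ℝ, -a - -b = -(a - b) by intros; ring, abs_neg] at hlt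
  · push Not at hR hL
    obtain ⟨a, ha, hap⟩ := hR
    obtain ⟨b, hb, hbp⟩ := hL
    have h1 := hr a ha
    have h2 := hr b hb
    rw [abs_of_nonpos (by linarith)] at h1
    rw [abs_of_nonneg (by linarith)] at h2
    set m := (s.sum + r.sum) / (n + 1)
    rcases le_total m e with h | h
    · refine ⟨b, hb, lt_of_lt_of_le ?_ (le_abs_self _)⟩
      rw [abs_of_nonneg (by linarith)]
      linarith
    · refine ⟨a, ha, lt_of_lt_of_le ?_ (neg_le_abs _)⟩
      rw [abs_of_nonpos (by linarith)]
      linarith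

/-- Gathering: while arrivals fall near a point `p` in a median gap of the core, each of them drives
out one of the original core points. At time `n` none of these is left. -/
lemma gather (hn : 2 ≤ n) {c : ℕ → Multiset ℝ} {u : ℕ → ℝ} {p η ρ : ℝ}
    (hη : 3 * (n + 1) * η < ρ) (hc : (c 0).card = n) (hnd : (c 0).Nodup)
    (hgap : ∀ x ∈ c 0, ρ ≤ |x - p|) (hsep : ∀ x ∈ c 0, ∀ y ∈ c 0, x ≠ y → ρ ≤ |x - y|)
    (hright : 2 * ((c 0).filter (p < ·)).card ≤ n + 1)
    (hleft : 2 * ((c 0).filter (· < p)).card ≤ n + 1)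
    (hstep : ∀ t < n, CoreStep (c t) (u t) (c (t + 1))) (hu : ∀ t < n, |u t - p| ≤ η) :
    ∀ t ≤ n, ∃ r ≤ c 0, r.card + t = n ∧ c t = (Multiset.range t).map u + r := by
  intro t
  induction t with
  | zero => exact fun _ => ⟨c 0, le_rfl, by simpa using hc, by simp⟩
  | succ t ih =>
    intro ht
    obtain ⟨r, hr, hrt, hct⟩ := ih (by omega)
    obtain ⟨e, he, hfar⟩ := hstep t (by omega)
    set s : Multiset ℝ := (Multiset.range (t + 1)).map u with hsdef
    have hs : u t ::ₘ c t = s + r := by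
      rw [hct, hsdef, Multiset.range_succ, Multiset.map_cons, Multiset.cons_add]
    have her : e ∈ r := by
      by_contra hner
      have hes : e ∈ s := by
        have : e ∈ s + r := by rw [← hs, he]; simp
        exact (Multiset.mem_add.1 this).resolve_right hner
      obtain ⟨w, hw, hlt⟩ := exists_farther hn (s := s) (r := r) (p := p) hη
        (by simp [hsdef]; omega)
        (by
          intro x hx
          obtain ⟨i, hi, rfl⟩ := Multiset.mem_map.1 hx
          exact hu i (by have := Multiset.mem_range.1 hi; omega))
        (fun x hx => hgap x (Multiset.mem_of_le hr hx))
        (by rintro rfl; simp at hrt; omega) (Multiset.nodup_of_le hr hnd)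
        (fun x hx y hy => hsep x (Multiset.mem_of_le hr hx) y (Multiset.mem_of_le hr hy))
        ((Nat.mul_le_mul_left 2 (Multiset.card_le_card (Multiset.filter_le_filter _ hr))).trans
          hright)
        ((Nat.mul_le_mul_left 2 (Multiset.card_le_card (Multiset.filter_le_filter _ hr))).trans
          hleft) hes
      have hle := hfar w (by rw [hs]; exact Multiset.mem_add.2 (Or.inr hw))
      rw [← Multiset.sum_cons, hs, Multiset.sum_add] at hle
      have hcard : ((c t).card : ℝ) = n := by
        have : (c t).card = n := by rw [hct]; simp; omega
        exact_mod_cast this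
      rw [hcard] at hle
      exact absurd hle (not_le.2 hlt)
    obtain ⟨r', rfl⟩ := Multiset.exists_cons_of_mem her
    refine ⟨r', (Multiset.le_cons_self r' e).trans hr, ?_, ?_⟩
    · simp at hrt; omega
    · rw [hs, Multiset.add_cons, Multiset.cons_inj_right] at he
      exact he.symm

/-! ### Moving the core along a route -/

lemma sum_range_quadratic (A B γ : ℝ) (n : ℕ) :
    2 * ∑ i ∈ Finset.range (n + 1), (A + B * i - γ * i ^ 2)
      = (n + 1) * (2 * A + B * n - γ * n ^ 2 + γ * (n * (n - 1)) / 3) := by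
  induction n with
  | zero => simp
  | succ n ih =>
    rw [Finset.sum_range_succ, mul_add, ih]
    push_cast
    ring

/-- If `v` is close to a quadratic sequence with positive, decreasing increments, then the mean of
its first `n + 1` terms lies to the right of their midrange, so that the leftmost point `v 0` is the
farthest from the mean. -/
lemma oldest_farthest (hn : 2 ≤ n) {v : ℕ → ℝ} {A B γ θ : ℝ} (hγ : 0 < γ) (hθ : 8 * θ ≤ γ)
    (hB : 2 * n * γ ≤ B) (hv : ∀ i ≤ n, |v i - (A + B * i - γ * i ^ 2)| ≤ θ)
    {j : ℕ} (hj : 1 ≤ j) (hjn : j ≤ n) :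
    |v j - (∑ i ∈ Finset.range (n + 1), v i) / (n + 1)|
      < |v 0 - (∑ i ∈ Finset.range (n + 1), v i) / (n + 1)| := by
  have hn2 : (2 : ℝ) ≤ n := by exact_mod_cast hn
  have hj1 : (1 : ℝ) ≤ j := by exact_mod_cast hj
  have hj2 : (j : ℝ) ≤ n := by exact_mod_cast hjn
  have h0 := abs_le.1 (hv 0 (by omega))
  have h1 := abs_le.1 (hv j hjn)
  simp only [Nat.cast_zero, mul_zero, add_zero, ne_eq, OfNat.ofNat_ne_zero, not_false_eq_true,
    zero_pow, sub_zero] at h0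
  have hsum : ∑ i ∈ Finset.range (n + 1), (A + B * i - γ * i ^ 2) - (n + 1) * θ
      ≤ ∑ i ∈ Finset.range (n + 1), v i := by
    have : ∑ i ∈ Finset.range (n + 1), ((A + B * i - γ * i ^ 2) - θ)
        ≤ ∑ i ∈ Finset.range (n + 1), v i :=
      Finset.sum_le_sum fun i hi => by
        linarith [(abs_le.1 (hv i (by have := Finset.mem_range.1 hi; omega))).1]
    rw [Finset.sum_sub_distrib] at this
    simpa using this
  have hq := sum_range_quadratic A B γ n
  set m := (∑ i ∈ Finset.range (n + 1), v i) / (n + 1) with hm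
  have hm2 : 2 * A + B * n - γ * n ^ 2 + γ * (n * (n - 1)) / 3 - 2 * θ ≤ 2 * m := by
    rw [hm, ← mul_div_assoc, le_div_iff₀ (by linarith)]
    linarith
  have hnn : γ * 2 ≤ γ * (n * (n - 1)) := mul_le_mul_of_nonneg_left (by nlinarith) hγ.le
  have hmono : B * j - γ * j ^ 2 ≤ B * n - γ * n ^ 2 := by
    have : 0 ≤ (n - j : ℝ) * (B - γ * (n + j)) := by
      apply mul_nonneg <;> nlinarith
    linarith
  have hinc : γ ≤ B * j - γ * j ^ 2 := by
    have e1 : 2 * n * γ * j ≤ B * j := mul_le_mul_of_nonneg_right hB (by linarith)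
    have e2 : γ * 1 ≤ γ * (j * (2 * n - j)) := mul_le_mul_of_nonneg_left (by nlinarith) hγ.le
    linarith
  have hlt : v 0 < v j := by linarith
  have hmid : v j + v 0 < 2 * m := by linarith
  refine lt_of_lt_of_le ?_ (neg_le_abs _)
  rw [abs_lt]
  constructor <;> linarith

/-- The route from `p` to `p + d`, which it reaches at time `M`, with increments that decrease in
absolute value. -/
def route (p d : ℝ) (M k : ℕ) : ℝ := p + d * ((k / M : ℝ) * (2 - k / M))

/-- The precision with which the arrivals have to follow the route. -/
def routeWidth (d : ℝ) (M : ℕ) : ℝ := |d| / (8 * M ^ 2)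

lemma routeWidth_pos {d : ℝ} (hd : d ≠ 0) {M : ℕ} (hM : M ≠ 0) : 0 < routeWidth d M := by
  have : 0 < |d| := abs_pos.2 hd
  unfold routeWidth
  positivity

lemma oldest_farthest_route (hn : 2 ≤ n) {u : ℕ → ℝ} {p d : ℝ} {M : ℕ} (hd : d ≠ 0)
    {k : ℕ} (hk : k + n ≤ M) (hu : ∀ t ≤ M, |u t - route p d M t| ≤ routeWidth d M)
    {j : ℕ} (hj : 1 ≤ j) (hjn : j ≤ n) :
    |u (k + j) - (∑ i ∈ Finset.range (n + 1), u (k + i)) / (n + 1)|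
      < |u k - (∑ i ∈ Finset.range (n + 1), u (k + i)) / (n + 1)| := by
  have hM : (0 : ℝ) < M := by exact_mod_cast (by omega : 0 < M)
  have hkM : (k : ℝ) + n ≤ M := by exact_mod_cast hk
  have hroute : ∀ i : ℕ, route p d M (k + i) = route p d M k
      + d / M ^ 2 * (2 * M - 2 * k) * i - d / M ^ 2 * i ^ 2 := by
    intro i
    unfold route
    push_cast
    field_simp
    ring
  rcases lt_or_gt_of_ne hd with h | h
  · have hv := oldest_farthest hn (v := fun i => -u (k + i)) (A := -route p d M k)
      (B := (-d) / M ^ 2 * (2 * M - 2 * k)) (γ := (-d) / M ^ 2) (θ := routeWidth d M)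
      (div_pos (by linarith) (by positivity))
      (by rw [routeWidth, abs_of_neg h]; apply le_of_eq; field_simp)
      (by
        have : 0 ≤ (-d) / (M : ℝ) ^ 2 := div_nonneg (by linarith) (by positivity)
        nlinarith)
      (fun i hi => by
        have := hu (k + i) (by omega)
        rw [hroute] at this
        rw [← abs_neg]
        refine le_of_eq_of_le (congrArg abs ?_) this
        ring) hj hjn
    simp only [Finset.sum_neg_distrib, neg_div, add_zero] at hv
    rwa [show ∀ a b : ℝ, -a - -b = -(a - b) by intros; ring, abs_neg,
      show ∀ a b : ℝ, -a - -b = -(a - b) by intros; ring, abs_neg] at hv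
  · exact oldest_farthest hn (v := fun i => u (k + i)) (A := route p d M k)
      (B := d / M ^ 2 * (2 * M - 2 * k)) (γ := d / M ^ 2) (θ := routeWidth d M)
      (div_pos h (by positivity))
      (by rw [routeWidth, abs_of_pos h]; apply le_of_eq; field_simp)
      (by
        have : 0 ≤ d / (M : ℝ) ^ 2 := by positivity
        nlinarith)
      (fun i hi => by
        have := hu (k + i) (by omega)
        rwa [hroute] at this) hj hjn

lemma map_range_succ' (f : ℕ → ℝ) (n : ℕ) :
    (Multiset.range (n + 1)).map f = f 0 ::ₘ (Multiset.range n).map fun i => f (1 + i) := by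
  rw [add_comm, Multiset.range_add_eq_union, ← Multiset.add_eq_union_iff_disjoint.2]
  · simp [Multiset.map_map]
  · rw [Multiset.disjoint_left]
    simp

/-- Travelling: while the arrivals follow the route, each of them drives out the oldest point. -/
lemma travel (hn : 2 ≤ n) {c : ℕ → Multiset ℝ} {u : ℕ → ℝ} {p d : ℝ} {M : ℕ} (hd : d ≠ 0)
    (hc : c n = (Multiset.range n).map u)
    (hstep : ∀ t ≤ M, CoreStep (c t) (u t) (c (t + 1)))
    (hu : ∀ t ≤ M, |u t - route p d M t| ≤ routeWidth d M) :
    ∀ k, k + n ≤ M + 1 → c (k + n) = (Multiset.range n).map fun i => u (k + i) := by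
  intro k
  induction k with
  | zero => intro _; simpa using hc
  | succ k ih =>
    intro hk
    have hck := ih (by omega)
    obtain ⟨e, he, hfar⟩ := hstep (k + n) (by omega)
    have hcons : u (k + n) ::ₘ c (k + n) = (Multiset.range (n + 1)).map fun i => u (k + i) := by
      rw [hck, Multiset.range_succ, Multiset.map_cons]
    -- every later arrival is strictly closer to the barycentre than `u k`
    have heq : e = u k := by
      have hmem : e ∈ (Multiset.range (n + 1)).map fun i => u (k + i) := by
        rw [← hcons, he]; simp
      obtain ⟨j, hj, rfl⟩ := Multiset.mem_map.1 hmem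
      rcases Nat.eq_zero_or_pos j with rfl | hj0
      · rfl
      have hlt := oldest_farthest_route hn hd (k := k) (by omega) hu (j := j) hj0
        (by have := Multiset.mem_range.1 hj; omega)
      have hle := hfar (u k) (by
        rw [hcons]; exact Multiset.mem_map.2 ⟨0, Multiset.mem_range.2 n.succ_pos, rfl⟩)
      rw [← Multiset.sum_cons, hcons, hck] at hle
      simp only [Multiset.card_map, Multiset.card_range] at hle
      exact absurd hle (not_le.2 hlt)
    rw [hcons, map_range_succ', heq, Nat.add_zero, Multiset.cons_inj_right] at he
    rw [show k + 1 + n = k + n + 1 by ring, ← he]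
    simp only [add_assoc]

lemma abs_route_sub_start_le {p d : ℝ} {M k : ℕ} (hk : k ≤ M) :
    |route p d M k - p| ≤ 2 * |d| * k / M := by
  rcases Nat.eq_zero_or_pos M with rfl | hM
  · simp [route]
  have hM' : (0 : ℝ) < M := by exact_mod_cast hM
  have h1 : (k / M : ℝ) ≤ 1 := by rw [div_le_one hM']; exact_mod_cast hk
  have h0 : (0 : ℝ) ≤ k / M := by positivity
  rw [route, add_sub_cancel_left, abs_mul, abs_of_nonneg (mul_nonneg h0 (by linarith)),
    show 2 * |d| * k / M = |d| * ((k / M : ℝ) * 2) by ring]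
  gcongr
  linarith

lemma abs_route_sub_end {p d : ℝ} {M k : ℕ} :
    |route p d M k - (p + d)| = |d| * (1 - k / M : ℝ) ^ 2 := by
  rw [route, show p + d * ((k / M : ℝ) * (2 - k / M)) - (p + d) = -(d * (1 - k / M : ℝ) ^ 2) by
    ring, abs_neg, abs_mul, abs_of_nonneg (sq_nonneg (1 - k / M : ℝ))]

lemma route_mem_Ioo {p d a b : ℝ} {M k : ℕ} (hk : k ≤ M) (hM : M ≠ 0)
    (hp : p ∈ Set.Ioo a b) (hpd : p + d ∈ Set.Ioo a b) : route p d M k ∈ Set.Ioo a b := by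
  have hM' : (0 : ℝ) < M := by exact_mod_cast Nat.pos_of_ne_zero hM
  have h1 : (k / M : ℝ) ≤ 1 := by rw [div_le_one hM']; exact_mod_cast hk
  have h0 : (0 : ℝ) ≤ k / M := by positivity
  have := (convex_Ioo a b) hp hpd (a := 1 - (k / M : ℝ) * (2 - k / M))
    (b := (k / M : ℝ) * (2 - k / M)) (by nlinarith [sq_nonneg (1 - (k / M : ℝ))])
    (mul_nonneg h0 (by linarith)) (by ring)
  convert this using 1
  simp only [route, smul_eq_mul]
  ring

/-- Steering: from a core with a wide median gap around `p`, arrivals that follow a slow route from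
`p` to `p + d` bring the whole core close to `p + d`. -/
lemma steer (hn : 2 ≤ n) {c : ℕ → Multiset ℝ} {u : ℕ → ℝ} {p d ρ ε : ℝ} {M : ℕ} (hd : d ≠ 0)
    (hnM : n ≤ M) (hMρ : 9 * (n + 1) ^ 2 * |d| < ρ * M) (hMε : 2 * (n + 1) * |d| ≤ ε * M)
    (hc : (c 0).card = n) (hnd : (c 0).Nodup)
    (hgap : ∀ x ∈ c 0, ρ ≤ |x - p|) (hsep : ∀ x ∈ c 0, ∀ y ∈ c 0, x ≠ y → ρ ≤ |x - y|)
    (hright : 2 * ((c 0).filter (p < ·)).card ≤ n + 1)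
    (hleft : 2 * ((c 0).filter (· < p)).card ≤ n + 1)
    (hstep : ∀ t ≤ M, CoreStep (c t) (u t) (c (t + 1)))
    (hu : ∀ t ≤ M, |u t - route p d M t| ≤ routeWidth d M) :
    ∀ x ∈ c (M + 1), |x - (p + d)| ≤ ε := by
  have hn2 : (2 : ℝ) ≤ n := by exact_mod_cast hn
  have hM : (1 : ℝ) ≤ M := by exact_mod_cast (by omega : 1 ≤ M)
  have hM0 : (0 : ℝ) < M := by linarith
  have hd0 : 0 < |d| := abs_pos.2 hd
  have hw : routeWidth d M ≤ |d| / M := by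
    rw [routeWidth]
    apply div_le_div_of_nonneg_left hd0.le hM0
    nlinarith
  obtain ⟨r, -, hr, hcn⟩ := gather hn (η := (2 * n + 1) * |d| / M) (u := u)
    (by
      rw [← mul_div_assoc, div_lt_iff₀ hM0]
      nlinarith) hc hnd hgap hsep hright hleft
    (fun t ht => hstep t (by omega))
    (fun t ht => by
      have h1 := hu t (by omega)
      have h2 := abs_route_sub_start_le (p := p) (d := d) (M := M) (k := t) (by omega)
      have h3 : 2 * |d| * t / M ≤ 2 * |d| * n / M := by
        gcongr
      have h4 := abs_sub_le (u t) (route p d M t) p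
      have h5 : (2 * n + 1) * |d| / M = 2 * |d| * n / M + |d| / M := by ring
      linarith) n le_rfl
  have hr0 : r = 0 := Multiset.card_eq_zero.1 (by omega)
  rw [hr0, add_zero] at hcn
  have hfin := travel hn hd hcn hstep hu (M + 1 - n) (by omega)
  rw [Nat.sub_add_cancel (by omega)] at hfin
  intro x hx
  rw [hfin] at hx
  obtain ⟨i, hi, rfl⟩ := Multiset.mem_map.1 hx
  have hi' := Multiset.mem_range.1 hi
  set t := M + 1 - n + i with ht
  have h1 := hu t (by omega)
  have h2 := abs_route_sub_end (p := p) (d := d) (M := M) (k := t)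
  have h4 := abs_sub_le (u t) (route p d M t) (p + d)
  have htM : (t : ℝ) ≤ M := by exact_mod_cast (by omega : t ≤ M)
  have htM' : (M : ℝ) ≤ t + n := by exact_mod_cast (by omega : M ≤ t + n)
  have h5 : (1 - t / M : ℝ) ^ 2 ≤ n / M := by
    have e1 : (1 - t / M : ℝ) = (M - t) / M := by field_simp
    have e2 : (M - t : ℝ) / M ≤ n / M := by gcongr; linarith
    have e3 : (0 : ℝ) ≤ (M - t) / M := div_nonneg (by linarith) hM0.le
    have e4 : (M - t : ℝ) / M ≤ 1 := by
      rw [div_le_one hM0]; linarith [(Nat.cast_nonneg t : (0 : ℝ) ≤ t)]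
    rw [e1]
    nlinarith
  have h6 : |d| * (1 - t / M : ℝ) ^ 2 ≤ |d| * (n / M) := mul_le_mul_of_nonneg_left h5 hd0.le
  have h7 : |d| * (n / M) + |d| / M ≤ ε := by
    have : |d| * (n / M) + |d| / M = (n + 1) * |d| / M := by ring
    rw [this, div_le_iff₀ hM0]
    nlinarith
  linarith

/-! ### The filtration of the configurations -/

/-- The σ-algebra generated by the configurations up to time `t`. -/
abbrev history {N : ℕ} {Ω : Type*} (X : ℕ → Ω → Fin N → ℝ) (t : ℕ) : MeasurableSpace Ω :=
  MeasurableSpace.comap (fun ω (s : Fin (t + 1)) => X s ω) inferInstance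

section History
variable {N : ℕ} {Ω : Type*} {X : ℕ → Ω → Fin N → ℝ}

lemma measurable_history {s t : ℕ} (hst : s ≤ t) : Measurable[history X t] (X s) :=
  (measurable_pi_apply (⟨s, Nat.lt_succ_of_le hst⟩ : Fin (t + 1))).comp
    (comap_measurable (fun ω (s : Fin (t + 1)) => X s ω))

lemma history_le [mΩ : MeasurableSpace Ω] (hX : ∀ t, Measurable (X t)) (t : ℕ) :
    history X t ≤ mΩ :=
  Measurable.comap_le (measurable_pi_iff.2 fun s => hX s)

lemma history_mono {s t : ℕ} (hst : s ≤ t) : history X s ≤ history X t := by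
  refine Measurable.comap_le ?_
  let := history X t
  exact measurable_pi_iff.2 fun r => measurable_history (by omega)

lemma comap_zero_le_history : MeasurableSpace.comap (X 0) inferInstance ≤ history X 0 :=
  Measurable.comap_le (measurable_history le_rfl)

end History

lemma measurable_core_apply (i : Fin n) : Measurable fun x : Fin (n + 1) → ℝ => core x i :=
  measurable_pi_apply _

lemma measurable_coreMean : Measurable (coreMean (n := n)) :=
  (Finset.measurable_sum _ fun i _ => measurable_core_apply i).div_const _

lemma measurable_coreSpread : Measurable (coreSpread (n := n)) :=
  (Finset.measurable_sum _ fun i _ =>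
    ((measurable_core_apply i).sub measurable_coreMean).pow_const 2).sqrt

section Dynamics
variable {Ω : Type*} [MeasurableSpace Ω] {P : Measure Ω}
  {X : ℕ → Ω → Fin (n + 1) → ℝ} {U : ℕ → Ω → ℝ}

/-- The next arrival can be integrated out, given the history. -/
lemma IsProcess.lintegral_arrival [IsProbabilityMeasure P] (h : IsProcess P X U) {t : ℕ} {E : Set Ω}
    (hE : MeasurableSet[history X t] E) {g : (Fin (n + 1) → ℝ) × ℝ → ℝ≥0∞} (hg : Measurable g) :
    ∫⁻ ω in E, g (X t ω, U (t + 1) ω) ∂P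
      = ∫⁻ ω in E, (∫⁻ u in Set.Icc (0 : ℝ) 1, g (X t ω, u)) ∂P := by
  have hE' := history_le h.measurable_config t _ hE
  obtain ⟨E₀, hE₀, rfl⟩ := hE
  set H : Ω → Fin (t + 1) → Fin (n + 1) → ℝ := fun ω s => X s ω with hH
  have hHm : Measurable H := measurable_pi_iff.2 fun s => h.measurable_config s
  have hUm := h.measurable_arrival t
  let G : (Fin (t + 1) → Fin (n + 1) → ℝ) × ℝ → ℝ≥0∞ :=
    (Prod.fst ⁻¹' E₀).indicator fun q => g (q.1 (Fin.last t), q.2)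
  have hG : Measurable G :=
    Measurable.indicator (hg.comp (by fun_prop)) (measurable_fst hE₀)
  have hlaw := (indepFun_iff_map_prod_eq_prod_map_map hUm.aemeasurable hHm.aemeasurable).1
    (h.arrival_indep t)
  have hlaw2 : P.map (fun ω => (H ω, U (t + 1) ω)) = (P.map H).prod (P.map (U (t + 1))) := by
    have : (fun ω => (H ω, U (t + 1) ω)) = Prod.swap ∘ fun ω => (U (t + 1) ω, H ω) := rfl
    rw [this, ← Measure.map_map measurable_swap (hUm.prodMk hHm), hlaw, Measure.prod_swap]
  have hXt : ∀ ω, H ω (Fin.last t) = X t ω := fun ω => rfl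
  calc ∫⁻ ω in H ⁻¹' E₀, g (X t ω, U (t + 1) ω) ∂P
      = ∫⁻ ω, G (H ω, U (t + 1) ω) ∂P := by
        rw [← lintegral_indicator hE']
        rfl
    _ = ∫⁻ q, G q ∂((P.map H).prod (P.map (U (t + 1)))) := by
        rw [← hlaw2, lintegral_map hG (hHm.prodMk hUm)]
    _ = ∫⁻ x, (∫⁻ u in Set.Icc (0 : ℝ) 1, G (x, u)) ∂(P.map H) := by
        rw [lintegral_prod _ hG.aemeasurable, h.arrival_law]
    _ = ∫⁻ ω, (∫⁻ u in Set.Icc (0 : ℝ) 1, G (H ω, u)) ∂P := by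
        rw [lintegral_map hG.lintegral_prod_right' hHm]
    _ = _ := by
        rw [← lintegral_indicator hE']
        refine lintegral_congr fun ω => ?_
        by_cases hω : H ω ∈ E₀
        · have : ω ∈ H ⁻¹' E₀ := hω
          simp [G, hω, this, hXt]
        · have : ω ∉ H ⁻¹' E₀ := hω
          simp [G, hω, this]

/-! ### Almost sure properties of the paths -/

lemma IsProcess.ae_coreStep (h : IsProcess P X U) : ∀ᵐ ω ∂P, ∀ t,
    CoreStep (coreMultiset (X t ω)) (U (t + 1) ω) (coreMultiset (X (t + 1) ω)) := by
  rw [ae_all_iff]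
  intro t
  filter_upwards [h.step t] with ω hω using coreStep_of_isBarycentricOrder hω

lemma IsProcess.ae_arrival_mem (h : IsProcess P X U) :
    ∀ᵐ ω ∂P, ∀ t, U (t + 1) ω ∈ Set.Icc (0 : ℝ) 1 := by
  rw [ae_all_iff]
  intro t
  refine ae_of_ae_map (h.measurable_arrival t).aemeasurable ?_
  rw [h.arrival_law]
  exact ae_restrict_mem measurableSet_Icc

lemma IsProcess.ae_core_mem (h : IsProcess P X U) :
    ∀ᵐ ω ∂P, ∀ t i, core (X t ω) i ∈ Set.Icc (0 : ℝ) 1 := by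
  filter_upwards [h.ae_coreStep, h.ae_arrival_mem, h.initial_mem] with ω h1 h2 h3 t
  induction t with
  | zero => exact fun i => h3 _
  | succ t ih =>
    intro i
    obtain ⟨e, he, -⟩ := h1 t
    have : core (X (t + 1) ω) i ∈ U (t + 1) ω ::ₘ coreMultiset (X t ω) := by
      rw [he]
      exact Multiset.mem_cons_of_mem (mem_coreMultiset.2 ⟨i, rfl⟩)
    rcases Multiset.mem_cons.1 this with hU | hc
    · rw [hU]; exact h2 t
    · obtain ⟨j, hj⟩ := mem_coreMultiset.1 hc
      rw [← hj]; exact ih j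

/-! ### The expected drift of the spread and the expected moves of the core -/

lemma ofReal_le_volume_ball_inter {b r : ℝ} (hb : b ∈ Set.Icc (0 : ℝ) 1) (hr : r ≤ 1 / 2) :
    ENNReal.ofReal r ≤ volume ({u | |u - b| ≤ r} ∩ Set.Icc (0 : ℝ) 1) := by
  rcases le_or_gt r 0 with h0 | h0
  · simp [ENNReal.ofReal_of_nonpos h0]
  rcases le_total b (1 / 2) with h | h
  · calc ENNReal.ofReal r = volume (Set.Icc b (b + r)) := by rw [Real.volume_Icc]; ring_nf
      _ ≤ _ := measure_mono fun u hu => by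
        refine ⟨show |u - b| ≤ r from abs_le.2 ⟨?_, ?_⟩, ?_, ?_⟩ <;> linarith [hu.1, hu.2, hb.1]
  · calc ENNReal.ofReal r = volume (Set.Icc (b - r) b) := by rw [Real.volume_Icc]; ring_nf
      _ ≤ _ := measure_mono fun u hu => by
        refine ⟨show |u - b| ≤ r from abs_le.2 ⟨?_, ?_⟩, ?_, ?_⟩ <;> linarith [hu.1, hu.2, hb.2]

lemma measurableSet_near {a : ℝ} : MeasurableSet
    {q : (Fin (n + 1) → ℝ) × ℝ | |q.2 - coreMean q.1| ≤ a * coreSpread q.1} :=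
  measurableSet_le (measurable_snd.sub (measurable_coreMean.comp measurable_fst)).abs
    ((measurable_coreSpread.comp measurable_fst).const_mul a)

lemma lintegral_indicator_near (x : Fin (n + 1) → ℝ) (a c : ℝ) :
    ∫⁻ u in Set.Icc (0 : ℝ) 1, Set.indicator
      {q : (Fin (n + 1) → ℝ) × ℝ | |q.2 - coreMean q.1| ≤ a * coreSpread q.1}
      (fun q => ENNReal.ofReal (c * coreSpread q.1)) (x, u)
    = ENNReal.ofReal (c * coreSpread x)
      * volume ({u | |u - coreMean x| ≤ a * coreSpread x} ∩ Set.Icc (0 : ℝ) 1) := by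
  have hm : MeasurableSet {u : ℝ | |u - coreMean x| ≤ a * coreSpread x} :=
    measurableSet_le (measurable_id.sub_const _).abs measurable_const
  rw [← Measure.restrict_apply hm, ← lintegral_indicator_const hm]
  rfl

/-- Each arrival lowers the expected spread by at least a multiple of the expected squared spread,
whatever event of the past is given. -/
lemma IsProcess.lintegral_coreSpread_succ [IsProbabilityMeasure P] (hn : n ≠ 0)
    (h : IsProcess P X U) {t : ℕ} {E : Set Ω}
    (hE : MeasurableSet[history X t] E) :
    ∫⁻ ω in E, ENNReal.ofReal (coreSpread (X (t + 1) ω)) ∂P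
        + ∫⁻ ω in E, ENNReal.ofReal (coreSpread (X t ω) ^ 2 / (32 * n ^ 2)) ∂P
      ≤ ∫⁻ ω in E, ENNReal.ofReal (coreSpread (X t ω)) ∂P := by
  have hn1 : (1 : ℝ) ≤ n := by exact_mod_cast Nat.one_le_iff_ne_zero.2 hn
  -- the drop of the spread is bounded below by `g`, whose integral over the arrival is explicit
  set S := {q : (Fin (n + 1) → ℝ) × ℝ | |q.2 - coreMean q.1| ≤ 1 / (4 * n) * coreSpread q.1}
    with hS
  set g : (Fin (n + 1) → ℝ) × ℝ → ℝ≥0∞ :=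
    S.indicator fun q => ENNReal.ofReal (1 / (8 * n) * coreSpread q.1) with hg
  have hgm : Measurable g := Measurable.indicator
    (((measurable_coreSpread.comp measurable_fst).const_mul _).ennreal_ofReal) measurableSet_near
  calc _ ≤ ∫⁻ ω in E, ENNReal.ofReal (coreSpread (X (t + 1) ω)) ∂P
        + ∫⁻ ω in E, (∫⁻ u in Set.Icc (0 : ℝ) 1, g (X t ω, u)) ∂P := by
        refine add_le_add_right (lintegral_mono_ae (ae_restrict_of_ae ?_)) _
        filter_upwards [h.ae_core_mem] with ω hω
        have hR := coreSpread_nonneg (X t ω)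
        have hR1 := coreSpread_le hn (hω t)
        rw [hg, hS, lintegral_indicator_near]
        calc ENNReal.ofReal (coreSpread (X t ω) ^ 2 / (32 * n ^ 2))
            = ENNReal.ofReal (1 / (8 * n) * coreSpread (X t ω))
              * ENNReal.ofReal (1 / (4 * n) * coreSpread (X t ω)) := by
              rw [← ENNReal.ofReal_mul (by positivity)]
              congr 1
              field_simp
              ring
          _ ≤ _ := by
              refine mul_le_mul_right (ofReal_le_volume_ball_inter
                (coreMean_mem_Icc hn (hω t)) ?_) _
              rw [one_div_mul_eq_div, div_le_iff₀ (by positivity)]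
              linarith
    _ = ∫⁻ ω in E, (ENNReal.ofReal (coreSpread (X (t + 1) ω)) + g (X t ω, U (t + 1) ω)) ∂P := by
        rw [← h.lintegral_arrival hE hgm, lintegral_add_left]
        exact (measurable_coreSpread.comp (h.measurable_config _)).ennreal_ofReal
    _ ≤ _ := by
        refine lintegral_mono_ae (ae_restrict_of_ae ?_)
        filter_upwards [h.ae_coreStep] with ω hω
        by_cases hq : (X t ω, U (t + 1) ω) ∈ S
        · have hq' := hq
          rw [hS, Set.mem_ofPred_eq, one_div_mul_eq_div] at hq'
          have := coreSpread_step_le_of_near hn (hω t) hq'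
          rw [hg, Set.indicator_of_mem hq, one_div_mul_eq_div,
            ← ENNReal.ofReal_add (coreSpread_nonneg _)
              (div_nonneg (coreSpread_nonneg _) (by positivity))]
          exact ENNReal.ofReal_le_ofReal this
        · rw [hg, Set.indicator_of_notMem hq, add_zero]
          exact ENNReal.ofReal_le_ofReal (coreSpread_step_le hn (hω t))

/-- The expected move of the core is at most a multiple of its expected squared spread: it only
moves if the arrival is close, and then not far. -/
lemma IsProcess.lintegral_edist_coreMean [IsProbabilityMeasure P] (hn : 2 ≤ n)
    (h : IsProcess P X U) {t : ℕ} {E : Set Ω}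
    (hE : MeasurableSet[history X t] E) :
    ∫⁻ ω in E, edist (coreMean (X t ω)) (coreMean (X (t + 1) ω)) ∂P
      ≤ ∫⁻ ω in E, ENNReal.ofReal (12 * coreSpread (X t ω) ^ 2) ∂P := by
  set S := {q : (Fin (n + 1) → ℝ) × ℝ | |q.2 - coreMean q.1| ≤ 3 * coreSpread q.1} with hS
  set g : (Fin (n + 1) → ℝ) × ℝ → ℝ≥0∞ :=
    S.indicator fun q => ENNReal.ofReal (2 * coreSpread q.1) with hg
  have hgm : Measurable g := Measurable.indicator
    (((measurable_coreSpread.comp measurable_fst).const_mul _).ennreal_ofReal) measurableSet_near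
  calc _ ≤ ∫⁻ ω in E, g (X t ω, U (t + 1) ω) ∂P := by
        refine lintegral_mono_ae (ae_restrict_of_ae ?_)
        filter_upwards [h.ae_coreStep] with ω hω
        rcases coreMean_step_le hn (hω t) with h0 | ⟨h1, h2⟩
        · rw [h0, edist_self]
          exact zero_le
        · rw [hg, Set.indicator_of_mem (show (X t ω, U (t + 1) ω) ∈ S from h1), edist_comm,
            edist_dist, Real.dist_eq]
          exact ENNReal.ofReal_le_ofReal h2
    _ = ∫⁻ ω in E, (∫⁻ u in Set.Icc (0 : ℝ) 1, g (X t ω, u)) ∂P := h.lintegral_arrival hE hgm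
    _ ≤ _ := by
        refine lintegral_mono fun ω => ?_
        have hR := coreSpread_nonneg (X t ω)
        rw [hg, hS, lintegral_indicator_near]
        calc _ ≤ ENNReal.ofReal (2 * coreSpread (X t ω))
              * volume (Set.Icc (coreMean (X t ω) - 3 * coreSpread (X t ω))
                (coreMean (X t ω) + 3 * coreSpread (X t ω))) := by
              refine mul_le_mul_right (measure_mono fun u hu => ?_) _
              have := abs_le.1 (show |u - coreMean (X t ω)| ≤ _ from hu.1)
              constructor <;> linarith
          _ = ENNReal.ofReal (12 * coreSpread (X t ω) ^ 2) := by
              rw [Real.volume_Icc, ← ENNReal.ofReal_mul (by positivity)]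
              congr 1
              ring

lemma IsProcess.sum_lintegral_sq_coreSpread [IsProbabilityMeasure P] (hn : n ≠ 0)
    (h : IsProcess P X U) {T : ℕ}
    {E : Set Ω} (hE : MeasurableSet[history X T] E) :
    ∑' k, ∫⁻ ω in E, ENNReal.ofReal (coreSpread (X (T + k) ω) ^ 2 / (32 * n ^ 2)) ∂P
      ≤ ∫⁻ ω in E, ENNReal.ofReal (coreSpread (X T ω)) ∂P := by
  have key : ∀ K, ∫⁻ ω in E, ENNReal.ofReal (coreSpread (X (T + K) ω)) ∂P
      + ∑ k ∈ Finset.range K,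
        ∫⁻ ω in E, ENNReal.ofReal (coreSpread (X (T + k) ω) ^ 2 / (32 * n ^ 2)) ∂P
      ≤ ∫⁻ ω in E, ENNReal.ofReal (coreSpread (X T ω)) ∂P := by
    intro K
    induction K with
    | zero => simp
    | succ K ih =>
      refine le_trans ?_ ih
      rw [Finset.sum_range_succ, add_comm (Finset.sum _ _), ← add_assoc]
      exact add_le_add_left
        (h.lintegral_coreSpread_succ hn (history_mono (Nat.le_add_right T K) _ hE)) _
  rw [ENNReal.tsum_eq_iSup_nat]
  exact iSup_le fun K => le_add_self.trans (key K)

/-- The expected total length of the path of the core is controlled by its initial spread. -/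
lemma IsProcess.lintegral_tsum_edist [IsProbabilityMeasure P] (hn : 2 ≤ n)
    (h : IsProcess P X U) {T : ℕ} {E : Set Ω} (hE : MeasurableSet[history X T] E) :
    ∫⁻ ω in E, ∑' k, edist (coreMean (X (T + k) ω)) (coreMean (X (T + (k + 1)) ω)) ∂P
      ≤ ENNReal.ofReal (384 * n ^ 2) * ∫⁻ ω in E, ENNReal.ofReal (coreSpread (X T ω)) ∂P := by
  have hm : ∀ t, Measurable fun ω => coreMean (X t ω) := fun t =>
    measurable_coreMean.comp (h.measurable_config t)
  rw [lintegral_tsum fun k => ((hm _).edist (hm _)).aemeasurable]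
  calc _ ≤ ∑' k, ENNReal.ofReal (384 * n ^ 2) *
        ∫⁻ ω in E, ENNReal.ofReal (coreSpread (X (T + k) ω) ^ 2 / (32 * n ^ 2)) ∂P := by
        refine ENNReal.tsum_le_tsum fun k => ?_
        refine (h.lintegral_edist_coreMean hn (history_mono (Nat.le_add_right T k) _ hE)).trans ?_
        rw [← lintegral_const_mul' _ _ ENNReal.ofReal_ne_top]
        refine le_of_eq (lintegral_congr fun ω => ?_)
        rw [← ENNReal.ofReal_mul (by positivity)]
        congr 1
        field_simp
        ring
    _ ≤ _ := by
        rw [ENNReal.tsum_mul_left]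
        exact mul_le_mul_right (h.sum_lintegral_sq_coreSpread (by omega) hE) _

lemma IsProcess.lintegral_coreSpread_le (hn : n ≠ 0) {a ε : ℝ} {T : ℕ} {E : Set Ω}
    (hE : MeasurableSet E)
    (hcore : ∀ᵐ ω ∂P, ω ∈ E → ∀ i, core (X T ω) i ∈ Set.Icc (a - ε) (a + ε)) :
    ∫⁻ ω in E, ENNReal.ofReal (coreSpread (X T ω)) ∂P ≤ ENNReal.ofReal (2 * n * ε) * P E := by
  rw [← setLIntegral_const]
  refine lintegral_mono_ae ?_
  rw [ae_restrict_iff' hE]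
  filter_upwards [hcore] with ω hω hωE
  refine ENNReal.ofReal_le_ofReal ((coreSpread_le hn (hω hωE)).trans (le_of_eq ?_))
  ring

/-! ### The limit of the core -/

lemma tendsto_core_of_tendsto {x : ℕ → Fin (n + 1) → ℝ} {l : ℝ}
    (hb : Tendsto (fun t => coreMean (x t)) atTop (𝓝 l))
    (hR : Tendsto (fun t => coreSpread (x t)) atTop (𝓝 0)) (i : Fin n) :
    Tendsto (fun t => core (x t) i) atTop (𝓝 l) := by
  have h0 : Tendsto (fun t => core (x t) i - coreMean (x t)) atTop (𝓝 0) :=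
    squeeze_zero_norm (fun t => abs_core_sub_coreMean_le (x t) i) hR
  simpa using h0.add hb

/-- The core converges: its path has finite length and its spread is square summable. -/
theorem IsProcess.exists_isCoreLimit [IsProbabilityMeasure P] (hn : 2 ≤ n) (h : IsProcess P X U) :
    ∃ ξ : Ω → ℝ, (∀ ω, ξ ω ∈ Set.Icc (0 : ℝ) 1) ∧ IsCoreLimit P X ξ := by
  have hn1 : (0 : ℝ) < n := by exact_mod_cast (by omega : 0 < n)
  have hm : ∀ t, Measurable fun ω => coreMean (X t ω) := fun t =>
    measurable_coreMean.comp (h.measurable_config t)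
  have hfin : ∫⁻ ω in Set.univ, ENNReal.ofReal (coreSpread (X 0 ω)) ∂P ≠ ∞ := by
    refine ne_top_of_le_ne_top ?_ (IsProcess.lintegral_coreSpread_le (P := P) (X := X) (T := 0)
      (a := 1 / 2) (ε := 1 / 2) (by omega) MeasurableSet.univ ?_)
    · exact ENNReal.mul_ne_top ENNReal.ofReal_ne_top (measure_ne_top _ _)
    · filter_upwards [h.ae_core_mem] with ω hω _ i
      norm_num
      exact hω 0 i
  have hlen := ne_top_of_le_ne_top (ENNReal.mul_ne_top ENNReal.ofReal_ne_top hfin)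
    (h.lintegral_tsum_edist hn (T := 0) MeasurableSet.univ)
  have hsq := ne_top_of_le_ne_top hfin
    (h.sum_lintegral_sq_coreSpread (by omega) (T := 0) MeasurableSet.univ)
  simp only [Measure.restrict_univ, zero_add] at hlen hsq
  have hsm : ∀ k, AEMeasurable
      (fun ω => ENNReal.ofReal (coreSpread (X k ω) ^ 2 / (32 * n ^ 2))) P := fun k =>
    (((measurable_coreSpread.comp (h.measurable_config k)).pow_const 2).div_const
      _).ennreal_ofReal.aemeasurable
  rw [← lintegral_tsum hsm] at hsq
  have hcauchy : ∀ᵐ ω ∂P, ∃ l, Tendsto (fun t => coreMean (X t ω)) atTop (𝓝 l) := by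
    filter_upwards [ae_lt_top' (AEMeasurable.tsum fun k =>
      ((hm k).edist (hm (k + 1))).aemeasurable) hlen] with ω hω
    exact cauchySeq_tendsto_of_complete
      (cauchySeq_of_edist_le_of_tsum_ne_top _ (fun k => le_rfl) hω.ne)
  have hspread : ∀ᵐ ω ∂P, Tendsto (fun t => coreSpread (X t ω)) atTop (𝓝 0) := by
    filter_upwards [ae_lt_top' (AEMeasurable.tsum hsm) hsq] with ω hω
    have h1 := (ENNReal.tendsto_toReal ENNReal.zero_ne_top).comp
      (ENNReal.tendsto_atTop_zero_of_tsum_ne_top hω.ne)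
    have h2 : Tendsto (fun t => coreSpread (X t ω) ^ 2 / (32 * n ^ 2)) atTop (𝓝 0) := by
      refine h1.congr fun t => ?_
      exact ENNReal.toReal_ofReal (by positivity)
    have h3 : Tendsto (fun t => coreSpread (X t ω) ^ 2) atTop (𝓝 0) := by
      have := h2.mul_const (32 * (n : ℝ) ^ 2)
      rw [zero_mul] at this
      exact this.congr fun t => div_mul_cancel₀ _ (by positivity)
    have h4 := (Real.continuous_sqrt.tendsto 0).comp h3
    rw [Real.sqrt_zero] at h4
    exact h4.congr fun t => Real.sqrt_sq (coreSpread_nonneg _)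
  obtain ⟨l, hlm, hl⟩ := measurable_limit_of_tendsto_metrizable_ae
    (fun t => (hm t).aemeasurable) hcauchy
  -- `l` is arbitrary on a null set, so it is truncated to stay in `[0,1]` everywhere
  refine ⟨fun ω => max 0 (min 1 (l ω)), fun ω => ⟨le_max_left _ _, ?_⟩,
    measurable_const.max (measurable_const.min hlm), ?_⟩
  · exact max_le zero_le_one (min_le_left _ _)
  filter_upwards [hl, hspread, h.ae_core_mem] with ω h1 h2 h3 i hi
  have hl01 : l ω ∈ Set.Icc (0 : ℝ) 1 :=
    isClosed_Icc.mem_of_tendsto h1 (Eventually.of_forall fun t =>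
      coreMean_mem_Icc (by omega) (h3 t))
  rw [min_eq_right hl01.2, max_eq_right hl01.1]
  exact tendsto_core_of_tendsto h1 h2 ⟨i, by omega⟩

lemma IsCoreLimit.ae_tendsto_coreMean (hn : n ≠ 0) {ξ : Ω → ℝ} (hξ : IsCoreLimit P X ξ) :
    ∀ᵐ ω ∂P, Tendsto (fun t => coreMean (X t ω)) atTop (𝓝 (ξ ω)) := by
  have hn1 : (n : ℝ) ≠ 0 := by exact_mod_cast hn
  filter_upwards [hξ.2] with ω hω
  have h1 : Tendsto (fun t => ∑ i, core (X t ω) i) atTop (𝓝 (∑ _i : Fin n, ξ ω)) :=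
    tendsto_finsetSum _ fun i _ => hω i.castSucc (by simp)
  have h2 := h1.div_const (n : ℝ)
  simpa [hn1, coreMean] using h2

/-- Given an event of the past on which the core is concentrated near `a`, the limit is near `a`
with probability at least one half. -/
theorem IsProcess.half_le_measure_limit_near [IsProbabilityMeasure P] (hn : 2 ≤ n)
    (h : IsProcess P X U) {ξ : Ω → ℝ}
    (hξ : IsCoreLimit P X ξ) {T : ℕ} {E : Set Ω} (hE : MeasurableSet[history X T] E) {a ε : ℝ}
    (hε : 0 < ε) (hcore : ∀ᵐ ω ∂P, ω ∈ E → ∀ i, core (X T ω) i ∈ Set.Icc (a - ε) (a + ε)) :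
    P E / 2 ≤ P (E ∩ {ω | |ξ ω - a| ≤ (1 + 1536 * n ^ 3) * ε}) := by
  have hn1 : (0 : ℝ) < n := by exact_mod_cast (by omega : 0 < n)
  have hE' := history_le h.measurable_config T _ hE
  have hbm : Measurable fun ω => coreMean (X T ω) :=
    measurable_coreMean.comp (h.measurable_config T)
  set r : ℝ := 1536 * n ^ 3 * ε with hr
  have hr0 : 0 < r := by positivity
  set f : Ω → ℝ≥0∞ := fun ω => edist (coreMean (X T ω)) (ξ ω) with hf
  have hfm : Measurable f := hbm.edist hξ.1
  have hint : ∫⁻ ω in E, f ω ∂P ≤ ENNReal.ofReal (r / 2) * P E := by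
    calc _ ≤ ∫⁻ ω in E,
          ∑' k, edist (coreMean (X (T + k) ω)) (coreMean (X (T + (k + 1)) ω)) ∂P := by
          refine lintegral_mono_ae (ae_restrict_of_ae ?_)
          filter_upwards [hξ.ae_tendsto_coreMean (by omega)] with ω hω
          exact edist_le_tsum_of_edist_le_of_tendsto₀
            (f := fun k => coreMean (X (T + k) ω)) _ (fun k => le_rfl)
            (hω.comp (tendsto_atTop_mono (fun k => Nat.le_add_left k T) tendsto_id))
      _ ≤ _ := h.lintegral_tsum_edist hn hE
      _ ≤ ENNReal.ofReal (384 * n ^ 2) * (ENNReal.ofReal (2 * n * ε) * P E) :=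
          mul_le_mul_right (IsProcess.lintegral_coreSpread_le (by omega) hE' hcore) _
      _ = ENNReal.ofReal (r / 2) * P E := by
          rw [← mul_assoc, ← ENNReal.ofReal_mul (by positivity), hr]
          congr 2
          ring
  have hmarkov : P (E ∩ {ω | ENNReal.ofReal r ≤ f ω}) ≤ P E / 2 := by
    have h1 := (mul_meas_ge_le_lintegral (μ := P.restrict E) hfm (ENNReal.ofReal r)).trans hint
    rw [Measure.restrict_apply (measurableSet_le measurable_const hfm), Set.inter_comm] at h1
    have h2 : ENNReal.ofReal (r / 2) * P E = ENNReal.ofReal r * (P E / 2) := by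
      rw [ENNReal.ofReal_div_of_pos (by norm_num), ENNReal.ofReal_ofNat, div_eq_mul_inv,
        div_eq_mul_inv, mul_assoc, mul_comm (2 : ℝ≥0∞)⁻¹]
    rw [h2] at h1
    exact (ENNReal.mul_le_mul_iff_right (by simpa using hr0) ENNReal.ofReal_ne_top).1 h1
  have hcover : P E ≤ P (E ∩ {ω | |ξ ω - a| ≤ (1 + 1536 * n ^ 3) * ε})
      + P (E ∩ {ω | ENNReal.ofReal r ≤ f ω}) := by
    refine le_trans (measure_mono_ae ?_) (measure_union_le _ _)
    filter_upwards [hcore] with ω hω hωE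
    have hωE : ω ∈ E := hωE
    have hb := coreMean_mem_Icc (by omega) (hω hωE)
    change ω ∈ (E ∩ {ω | |ξ ω - a| ≤ (1 + 1536 * n ^ 3) * ε}) ∪
      (E ∩ {ω | ENNReal.ofReal r ≤ f ω})
    by_cases hfr : ENNReal.ofReal r ≤ f ω
    · exact Or.inr ⟨hωE, hfr⟩
    · refine Or.inl ⟨hωE, ?_⟩
      rw [not_le, hf, edist_lt_ofReal, Real.dist_eq] at hfr
      have hfr := abs_lt.1 hfr
      rw [Set.mem_ofPred_eq, abs_le]
      constructor <;> nlinarith [hb.1, hb.2]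
  have hsum : P E / 2 + P E / 2
      ≤ P (E ∩ {ω | |ξ ω - a| ≤ (1 + 1536 * n ^ 3) * ε}) + P E / 2 := by
    rw [ENNReal.add_halves]
    exact hcover.trans (add_le_add_right hmarkov _)
  exact (ENNReal.add_le_add_iff_right
    (ENNReal.div_ne_top (measure_ne_top _ _) (by norm_num))).1 hsum

end Dynamics

/-! ### Prescribing the first arrivals -/

/-- The arrival at time `t + 1`, recovered from the configurations at times `t` and `t + 1`. -/
def recoveredArrival {Ω : Type*} (X : ℕ → Ω → Fin (n + 1) → ℝ) (t : ℕ) (ω : Ω) : ℝ :=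
  ∑ i, X (t + 1) ω i - ∑ i, core (X t ω) i

/-- The event that `E` occurs and that the first `k` arrivals fall into the prescribed sets. It is
formulated with the recovered arrivals because `U (t + 1)` need not be determined by the
configurations pointwise, but only almost surely. -/
def guidedEvent {Ω : Type*} (X : ℕ → Ω → Fin (n + 1) → ℝ) (B : ℕ → Set ℝ) (E : Set Ω) :
    ℕ → Set Ω
  | 0 => E
  | k + 1 => guidedEvent X B E k ∩ recoveredArrival X k ⁻¹' B k

section Guided
variable {Ω : Type*} {X : ℕ → Ω → Fin (n + 1) → ℝ} {U : ℕ → Ω → ℝ} {B : ℕ → Set ℝ} {E : Set Ω}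

lemma mem_of_mem_guidedEvent {k : ℕ} {ω : Ω} (h : ω ∈ guidedEvent X B E k) :
    ω ∈ E ∧ ∀ t < k, recoveredArrival X t ω ∈ B t := by
  induction k with
  | zero => exact ⟨h, by simp⟩
  | succ k ih =>
    obtain ⟨h1, h2⟩ := ih h.1
    refine ⟨h1, fun t ht => ?_⟩
    rcases Nat.lt_succ_iff_lt_or_eq.1 ht with hlt | rfl
    · exact h2 t hlt
    · exact h.2

lemma measurable_recoveredArrival (t : ℕ) :
    Measurable[history X (t + 1)] (recoveredArrival X t) := by
  let := history X (t + 1)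
  have h1 : Measurable (X (t + 1)) := measurable_history le_rfl
  have h2 : Measurable (X t) := measurable_history (Nat.le_succ t)
  exact (Finset.measurable_sum _ fun i _ => (measurable_pi_apply i).comp h1).sub
    (Finset.measurable_sum _ fun i _ => (measurable_core_apply i).comp h2)

lemma measurableSet_guidedEvent (hB : ∀ t, MeasurableSet (B t))
    (hE : MeasurableSet[history X 0] E) (k : ℕ) :
    MeasurableSet[history X k] (guidedEvent X B E k) := by
  induction k with
  | zero => exact hE
  | succ k ih =>
    exact MeasurableSet.inter (history_mono (Nat.le_succ k) _ ih)
      (measurable_recoveredArrival k (hB k))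

variable [MeasurableSpace Ω] {P : Measure Ω}

lemma IsProcess.ae_recoveredArrival_eq (h : IsProcess P X U) :
    ∀ᵐ ω ∂P, ∀ t, recoveredArrival X t ω = U (t + 1) ω := by
  rw [ae_all_iff]
  intro t
  filter_upwards [h.step t] with ω hω
  obtain ⟨⟨σ, hσ⟩, -⟩ := hω
  have : ∑ i, X (t + 1) ω i = ∑ i, replaceLast (X t ω) (U (t + 1) ω) i := by
    rw [hσ]
    exact Equiv.sum_comp σ _
  rw [recoveredArrival, this, replaceLast_eq_snoc, Fin.sum_univ_castSucc]
  simp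

lemma IsProcess.measure_guidedEvent [IsProbabilityMeasure P] (h : IsProcess P X U)
    (hB : ∀ t, MeasurableSet (B t)) (hE : MeasurableSet[history X 0] E) (k : ℕ) :
    P (guidedEvent X B E k)
      = (∏ t ∈ Finset.range k, volume (B t ∩ Set.Icc (0 : ℝ) 1)) * P E := by
  induction k with
  | zero => simp [guidedEvent]
  | succ k ih =>
    have hEk := measurableSet_guidedEvent hB hE k
    have hg : Measurable fun q : (Fin (n + 1) → ℝ) × ℝ => (B k).indicator (1 : ℝ → ℝ≥0∞) q.2 :=
      (measurable_one.indicator (hB k)).comp measurable_snd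
    have hint := h.lintegral_arrival hEk hg
    have hUB : MeasurableSet (U (k + 1) ⁻¹' B k) := h.measurable_arrival k (hB k)
    have e1 : ∀ ω, (B k).indicator (1 : ℝ → ℝ≥0∞) (U (k + 1) ω)
        = (U (k + 1) ⁻¹' B k).indicator 1 ω := fun ω => rfl
    simp only [e1, lintegral_indicator_one hUB, lintegral_indicator_one (hB k),
      setLIntegral_const, Measure.restrict_apply hUB, Measure.restrict_apply (hB k)] at hint
    rw [Finset.prod_range_succ, mul_right_comm, ← ih, mul_comm, ← hint, Set.inter_comm]
    refine measure_congr ?_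
    filter_upwards [h.ae_recoveredArrival_eq] with ω hω
    apply propext
    change ω ∈ guidedEvent X B E k ∩ recoveredArrival X k ⁻¹' B k
      ↔ ω ∈ guidedEvent X B E k ∩ U (k + 1) ⁻¹' B k
    rw [Set.mem_inter_iff, Set.mem_inter_iff, Set.mem_preimage, Set.mem_preimage, hω k]

end Guided

/-! ### Reaching a neighbourhood of a given point -/

/-- The core points of `x` keep distance `ρ` from each other and from `p`, and at most half of the
number `n + 1` of all points lie in the core on each side of `p`. -/
def HasMedianGap (p ρ : ℝ) (x : Fin (n + 1) → ℝ) : Prop :=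
  (∀ i, ρ ≤ |core x i - p|) ∧ (∀ i j, i ≠ j → ρ ≤ |core x i - core x j|) ∧
    2 * (Finset.univ.filter fun i => p < core x i).card ≤ n + 1 ∧
    2 * (Finset.univ.filter fun i => core x i < p).card ≤ n + 1

lemma measurableSet_hasMedianGap (p ρ : ℝ) :
    MeasurableSet {x : Fin (n + 1) → ℝ | HasMedianGap p ρ x} := by
  have hc := measurable_core_apply (n := n)
  have hcount : ∀ q : Fin n → (Fin (n + 1) → ℝ) → Prop, (∀ i, MeasurableSet {x | q i x}) →
      ∀ [∀ i x, Decidable (q i x)],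
      MeasurableSet {x | 2 * (Finset.univ.filter fun i => q i x).card ≤ n + 1} := by
    intro q hq _
    simp only [Finset.card_filter]
    exact measurableSet_le ((Finset.measurable_sum _ fun i _ =>
      Measurable.ite (hq i) measurable_const measurable_const).const_mul 2) measurable_const
  refine MeasurableSet.inter ?_ (MeasurableSet.inter ?_ (MeasurableSet.inter ?_ ?_))
  · exact measurableSet_setOfPred.2 (Measurable.forall fun i => measurableSet_setOfPred.1
      (measurableSet_le measurable_const ((hc i).sub_const p).abs))
  · refine measurableSet_setOfPred.2 (Measurable.forall fun i => Measurable.forall fun j =>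
      Measurable.imp measurable_const (measurableSet_setOfPred.1
      (measurableSet_le measurable_const ((hc i).sub (hc j)).abs)))
  · exact hcount _ fun i => measurableSet_lt measurable_const (hc i)
  · exact hcount _ fun i => measurableSet_lt (hc i) measurable_const

lemma volume_near_inter_pos {a r : ℝ} (ha : a ∈ Set.Ioo (0 : ℝ) 1) (hr : 0 < r) :
    0 < volume ({u | |u - a| ≤ r} ∩ Set.Icc (0 : ℝ) 1) := by
  refine lt_of_lt_of_le ((Metric.isOpen_ball.inter isOpen_Ioo).measure_pos volume
    ⟨a, Metric.mem_ball_self hr, ha⟩) (measure_mono (Set.inter_subset_inter (fun u hu => ?_)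
      Set.Ioo_subset_Icc_self))
  have := (Metric.mem_ball.1 hu).le
  rwa [Real.dist_eq] at this

/-- From a core with a wide median gap around `p`, the limit gets close to any other point `a` with
a probability that is bounded below. -/
theorem exists_pos_le_measure_limit_near.{w} (hn : 2 ≤ n) {p a ρ ε : ℝ} (hρ : 0 < ρ) (hε : 0 < ε)
    (hp : p ∈ Set.Ioo (0 : ℝ) 1) (ha : a ∈ Set.Ioo (0 : ℝ) 1) (hpa : a ≠ p) :
    ∃ δ : ℝ, 0 < δ ∧ ∀ (Ω : Type w) [MeasurableSpace Ω] (P : Measure Ω) [IsProbabilityMeasure P]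
      (X : ℕ → Ω → Fin (n + 1) → ℝ) (U : ℕ → Ω → ℝ), IsProcess P X U →
      ∀ ξ : Ω → ℝ, IsCoreLimit P X ξ → ∀ E : Set Ω, MeasurableSet[history X 0] E →
        (∀ ω ∈ E, HasMedianGap p ρ (X 0 ω)) →
        ENNReal.ofReal δ * P E ≤ P (E ∩ {ω | |ξ ω - a| ≤ ε}) := by
  have hd : a - p ≠ 0 := sub_ne_zero.2 hpa
  set C : ℝ := 1 + 1536 * n ^ 3 with hC
  have hC0 : 0 < C := by positivity
  -- the route needs so many steps that its first `n` points stay in the gap around `p` and its last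
  -- `n` points are within `ε / C` of `a`
  obtain ⟨M, hM⟩ := exists_nat_gt (max (n : ℝ)
    (max (9 * (n + 1) ^ 2 * |a - p| / ρ) (2 * (n + 1) * |a - p| / (ε / C))))
  simp only [max_lt_iff] at hM
  obtain ⟨hM1, hM2, hM3⟩ := hM
  have hM1 : n ≤ M := by exact_mod_cast hM1.le
  rw [div_lt_iff₀ hρ] at hM2
  rw [div_lt_iff₀ (by positivity)] at hM3
  set B : ℕ → Set ℝ := fun t => {u | |u - route p (a - p) M t| ≤ routeWidth (a - p) M} with hBdef
  have hB : ∀ t, MeasurableSet (B t) := fun t =>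
    measurableSet_le (measurable_id.sub_const _).abs measurable_const
  set π : ℝ≥0∞ := ∏ t ∈ Finset.range (M + 1), volume (B t ∩ Set.Icc (0 : ℝ) 1) with hπ
  have hπ0 : π ≠ 0 := by
    refine Finset.prod_ne_zero_iff.2 fun t ht => (volume_near_inter_pos
      (route_mem_Ioo (by have := Finset.mem_range.1 ht; omega) (by omega) hp (by simpa using ha))
      (routeWidth_pos hd (by omega))).ne'
  have hπt : π ≠ ∞ := ENNReal.prod_ne_top fun t _ =>
    ne_top_of_le_ne_top (by simp) (measure_mono (Set.inter_subset_right (s := B t)))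
  refine ⟨π.toReal / 2, half_pos (ENNReal.toReal_pos hπ0 hπt), ?_⟩
  intro Ω _ P _ X U h ξ hξ E hE hgap
  have hEM := measurableSet_guidedEvent hB hE (M + 1)
  have hhalf := h.half_le_measure_limit_near hn hξ hEM (a := a) (ε := ε / C) (by positivity) (by
    filter_upwards [h.ae_coreStep, h.ae_recoveredArrival_eq] with ω hstep hrec hω i
    obtain ⟨hωE, hωB⟩ := mem_of_mem_guidedEvent hω
    obtain ⟨g1, g2, g3, g4⟩ := hgap ω hωE
    have hinj : Function.Injective (core (X 0 ω)) := by
      intro i j hij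
      by_contra hne
      have := g2 i j hne
      rw [hij, sub_self, abs_zero] at this
      linarith
    have hst := steer hn (c := fun t => coreMultiset (X t ω)) (u := fun t => U (t + 1) ω)
      (p := p) (ρ := ρ) (ε := ε / C) hd hM1 (by linarith) (by linarith)
      (card_coreMultiset _) (Finset.univ.nodup.map hinj)
      (by
        intro x hx
        obtain ⟨i, rfl⟩ := mem_coreMultiset.1 hx
        exact g1 i)
      (by
        intro x hx y hy hxy
        obtain ⟨i, rfl⟩ := mem_coreMultiset.1 hx
        obtain ⟨j, rfl⟩ := mem_coreMultiset.1 hy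
        exact g2 i j fun hij => hxy (by rw [hij]))
      (by
        rw [coreMultiset, Multiset.filter_map, Multiset.card_map]
        exact g3)
      (by
        rw [coreMultiset, Multiset.filter_map, Multiset.card_map]
        exact g4)
      (fun t _ => hstep t)
      (fun t ht => by
        rw [← hrec t]
        exact hωB t (by omega))
      (core (X (M + 1) ω) i) (mem_coreMultiset.2 ⟨i, rfl⟩)
    rw [add_sub_cancel] at hst
    have := abs_le.1 hst
    constructor <;> linarith)
  rw [h.measure_guidedEvent hB hE, ← hC, mul_div_cancel₀ _ hC0.ne', ← hπ] at hhalf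
  calc ENNReal.ofReal (π.toReal / 2) * P E = π * P E / 2 := by
        rw [ENNReal.ofReal_div_of_pos (by norm_num), ENNReal.ofReal_toReal hπt,
          ENNReal.ofReal_ofNat, div_eq_mul_inv, div_eq_mul_inv, mul_right_comm]
    _ ≤ _ := hhalf
    _ ≤ _ := measure_mono (Set.inter_subset_inter_left _
        fun ω hω => (mem_of_mem_guidedEvent hω).1)

/-! ### Median gaps of separated configurations -/

/-- An injective real function on a set of `n` points has a value such that each of the two parts
of the set, where the function is larger and where it is at most this value, has at most
`(n + 1) / 2` elements. -/
lemma exists_median (hn : 2 ≤ n) (f : Fin n → ℝ) (hf : Function.Injective f) :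
    ∃ i₀, 2 * (Finset.univ.filter fun i => f i₀ < f i).card ≤ n + 1 ∧
      2 * (Finset.univ.filter fun i => f i ≤ f i₀).card ≤ n + 1 := by
  have : Nonempty (Fin n) := ⟨⟨0, by omega⟩⟩
  let S := Finset.univ.filter fun i₀ => 2 * (Finset.univ.filter fun i => f i₀ < f i).card ≤ n + 1
  have hS : S.Nonempty := by
    obtain ⟨i, -, hi⟩ := Finset.exists_max_image Finset.univ f Finset.univ_nonempty
    refine ⟨i, Finset.mem_filter.2 ⟨Finset.mem_univ _, ?_⟩⟩
    rw [Finset.filter_eq_empty_iff.2 fun j hj => not_lt.2 (hi j hj)]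
    simp
  obtain ⟨i₀, hi₀, hmin⟩ := Finset.exists_min_image S f hS
  refine ⟨i₀, (Finset.mem_filter.1 hi₀).2, ?_⟩
  by_cases hlow : ∃ j, f j < f i₀
  · -- the value just below `f i₀` has too many values above it
    obtain ⟨j, hj, hjmax⟩ := Finset.exists_max_image (Finset.univ.filter fun j => f j < f i₀) f
      (by obtain ⟨j, hj⟩ := hlow; exact ⟨j, by simpa using hj⟩)
    simp only [Finset.mem_filter, Finset.mem_univ, true_and] at hj hjmax
    have hjS : j ∉ S := fun h => absurd (hmin j h) (not_le.2 hj)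
    simp only [S, Finset.mem_filter, Finset.mem_univ, true_and, not_le] at hjS
    have hsub : (Finset.univ.filter fun i => f i ≤ f i₀) ⊆
        insert i₀ (Finset.univ.filter fun i => ¬ f j < f i) := by
      intro i hi
      simp only [Finset.mem_filter, Finset.mem_univ, true_and, Finset.mem_insert, not_lt] at hi ⊢
      rcases hi.lt_or_eq with h | h
      · exact Or.inr (hjmax i h)
      · exact Or.inl (hf h)
    have h1 := (Finset.card_le_card hsub).trans (Finset.card_insert_le _ _)
    have h2 := Finset.card_filter_add_card_filter_not (s := (Finset.univ : Finset (Fin n)))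
      (fun i => f j < f i)
    rw [Finset.card_univ, Fintype.card_fin] at h2
    omega
  · push Not at hlow
    have hsub : (Finset.univ.filter fun i => f i ≤ f i₀) ⊆ {i₀} := by
      intro i hi
      simp only [Finset.mem_filter, Finset.mem_univ, true_and, Finset.mem_singleton] at hi ⊢
      exact hf (le_antisymm hi (hlow i))
    have := Finset.card_le_card hsub
    simp only [Finset.card_singleton] at this
    omega

/-- A separated configuration has a wide median gap, whose position can be taken on a grid. -/
lemma exists_hasMedianGap (hn : 2 ≤ n) {x : Fin (n + 1) → ℝ} {ρ : ℝ} (hρ : 0 < ρ)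
    (hx : ∀ i, core x i ∈ Set.Icc ρ (1 - ρ))
    (hsep : ∀ i j, i ≠ j → ρ ≤ |core x i - core x j|) :
    ∃ k < ⌈8 / ρ⌉₊, k * (ρ / 8) ∈ Set.Ioo (0 : ℝ) 1 ∧ HasMedianGap (k * (ρ / 8)) (ρ / 4) x := by
  have hinj : Function.Injective (core x) := by
    intro i j hij
    by_contra hne
    have := hsep i j hne
    rw [hij, sub_self, abs_zero] at this
    linarith
  obtain ⟨i₀, h1, h2⟩ := exists_median hn (core x) hinj
  set y := core x i₀ with hy
  have hy1 := hx i₀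
  rw [← hy] at hy1
  have hρ8 : 0 < ρ / 8 := by positivity
  set k := ⌊(y + ρ / 2) / (ρ / 8)⌋₊ with hk
  have hk1 : k * (ρ / 8) ≤ y + ρ / 2 := by
    rw [← le_div_iff₀ hρ8]
    exact Nat.floor_le (div_nonneg (by linarith [hy1.1]) hρ8.le)
  have hk2 : y + 3 * ρ / 8 < k * (ρ / 8) := by
    have := Nat.lt_floor_add_one ((y + ρ / 2) / (ρ / 8))
    rw [← hk, div_lt_iff₀ hρ8] at this
    linarith
  have hmem : k * (ρ / 8) ∈ Set.Ioo (0 : ℝ) 1 := ⟨by linarith [hy1.1], by linarith [hy1.2]⟩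
  have habove : ∀ i, y < core x i → y + ρ ≤ core x i := by
    intro i hi
    have := hsep i i₀ (by rintro rfl; exact lt_irrefl _ hi)
    rw [← hy, abs_of_pos (by linarith)] at this
    linarith
  refine ⟨k, ?_, hmem, fun i => ?_, fun i j hij => ?_, ?_, ?_⟩
  · rw [Nat.lt_ceil, lt_div_iff₀ hρ]
    linarith [hmem.2]
  · rcases le_or_gt (core x i) y with h | h
    · rw [abs_of_neg (by linarith)]; linarith
    · have := habove i h
      rw [abs_of_pos (by linarith)]; linarith
  · linarith [hsep i j hij]
  · refine le_trans (Nat.mul_le_mul_left 2 (Finset.card_le_card fun i hi => ?_)) h1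
    simp only [Finset.mem_filter, Finset.mem_univ, true_and] at hi ⊢
    linarith
  · refine le_trans (Nat.mul_le_mul_left 2 (Finset.card_le_card fun i hi => ?_)) h2
    simp only [Finset.mem_filter, Finset.mem_univ, true_and] at hi ⊢
    by_contra h
    have := habove i (not_le.1 h)
    linarith

section Spacing
variable {N : ℕ}

lemma withEndpoints_zero (x : Fin N → ℝ) : withEndpoints x 0 = 0 := rfl

lemma withEndpoints_last (x : Fin N → ℝ) : withEndpoints x (Fin.last (N + 1)) = 1 := by
  rw [withEndpoints, ← Fin.succ_last, Fin.cons_succ, Fin.snoc_last]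

lemma withEndpoints_succ_castSucc (x : Fin N → ℝ) (i : Fin N) :
    withEndpoints x i.castSucc.succ = x i := by
  rw [withEndpoints, Fin.cons_succ, Fin.snoc_castSucc]

lemma minSpacing_le (x : Fin N → ℝ) {a b : Fin (N + 2)} (h : a ≠ b) :
    minSpacing x ≤ |withEndpoints x a - withEndpoints x b| :=
  ciInf_le (Set.finite_range _).bddBelow
    (⟨(a, b), h⟩ : {p : Fin (N + 2) × Fin (N + 2) // p.1 ≠ p.2})

lemma le_abs_sub_of_le_minSpacing {x : Fin N → ℝ} {ρ : ℝ} (h : ρ ≤ minSpacing x) {i j : Fin N}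
    (hij : i ≠ j) : ρ ≤ |x i - x j| := by
  have := minSpacing_le x (a := i.castSucc.succ) (b := j.castSucc.succ) (by simpa using hij)
  rw [withEndpoints_succ_castSucc, withEndpoints_succ_castSucc] at this
  exact h.trans this

lemma mem_Icc_of_le_minSpacing {x : Fin N → ℝ} {ρ : ℝ} (h : ρ ≤ minSpacing x) {i : Fin N}
    (hi : x i ∈ Set.Icc (0 : ℝ) 1) : x i ∈ Set.Icc ρ (1 - ρ) := by
  have h0 := minSpacing_le x (a := i.castSucc.succ) (b := 0) (Fin.succ_ne_zero _)
  have h1 := minSpacing_le x (a := Fin.last (N + 1)) (b := i.castSucc.succ)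
    (by rw [← Fin.succ_last, Ne, Fin.succ_inj]; exact (Fin.castSucc_lt_last i).ne')
  rw [withEndpoints_succ_castSucc, withEndpoints_zero, sub_zero, abs_of_nonneg hi.1] at h0
  rw [withEndpoints_succ_castSucc, withEndpoints_last,
    abs_of_nonneg (by linarith [hi.2])] at h1
  constructor <;> linarith

lemma le_minSpacing {x : Fin N → ℝ} {ρ : ℝ} (hρ : ρ ≤ 1)
    (hmem : ∀ i, x i ∈ Set.Icc ρ (1 - ρ)) (hsep : ∀ i j, i ≠ j → ρ ≤ |x i - x j|) :
    ρ ≤ minSpacing x := by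
  have : Nonempty {p : Fin (N + 2) × Fin (N + 2) // p.1 ≠ p.2} := ⟨⟨(0, 1), by simp⟩⟩
  have key : ∀ a b : Fin (N + 2), a ≠ b → ρ ≤ |withEndpoints x a - withEndpoints x b| := by
    have h01 : ρ ≤ |(0 : ℝ) - 1| := by norm_num; exact hρ
    have h0 : ∀ i, ρ ≤ |0 - x i| := fun i => by
      rw [zero_sub, abs_neg]; exact (hmem i).1.trans (le_abs_self _)
    have h1 : ∀ i, ρ ≤ |1 - x i| := fun i =>
      le_trans (by linarith [(hmem i).2]) (le_abs_self _)
    intro a b hab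
    induction a using Fin.cases with
    | zero =>
      induction b using Fin.cases with
      | zero => exact absurd rfl hab
      | succ b =>
        rw [withEndpoints_zero]
        induction b using Fin.lastCases with
        | last => rw [Fin.succ_last, withEndpoints_last]; exact h01
        | cast j => rw [withEndpoints_succ_castSucc]; exact h0 j
    | succ a =>
      induction b using Fin.cases with
      | zero =>
        rw [withEndpoints_zero, abs_sub_comm]
        induction a using Fin.lastCases with
        | last => rw [Fin.succ_last, withEndpoints_last]; exact h01
        | cast j => rw [withEndpoints_succ_castSucc]; exact h0 j
      | succ b =>
        induction a using Fin.lastCases with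
        | last =>
          induction b using Fin.lastCases with
          | last => exact absurd rfl hab
          | cast j =>
            rw [Fin.succ_last, withEndpoints_last, withEndpoints_succ_castSucc]; exact h1 j
        | cast i =>
          induction b using Fin.lastCases with
          | last =>
            rw [Fin.succ_last, withEndpoints_last, withEndpoints_succ_castSucc, abs_sub_comm]
            exact h1 i
          | cast j =>
            rw [withEndpoints_succ_castSucc, withEndpoints_succ_castSucc]
            exact hsep i j fun hij => hab (by rw [hij])
  exact le_ciInf fun p => key _ _ p.2

end Spacing

/-! ### The conditional law of the limit -/

lemma exists_Icc_subset {I : Set ℝ} (hI : I.OrdConnected) (hvol : 0 < volume I) :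
    ∃ x y, x < y ∧ Set.Icc x y ⊆ I := by
  have : I.Nontrivial := by
    by_contra h
    exact hvol.ne' ((Set.not_nontrivial_iff.1 h).measure_zero volume)
  obtain ⟨x, hx, y, hy, hxy⟩ := this.exists_lt
  exact ⟨x, y, hxy, hI.out hx hy⟩

lemma exists_near_subset {I : Set ℝ} (hI : I.OrdConnected) (hI1 : I ⊆ Set.Icc (0 : ℝ) 1)
    (hvol : 0 < volume I) (p : ℝ) :
    ∃ a ε, 0 < ε ∧ a ∈ Set.Ioo (0 : ℝ) 1 ∧ a ≠ p ∧ ∀ u, |u - a| ≤ ε → u ∈ I := by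
  obtain ⟨x, y, hxy, hsub⟩ := exists_Icc_subset hI hvol
  have hx := hI1 (hsub (Set.left_mem_Icc.2 hxy.le))
  have hy := hI1 (hsub (Set.right_mem_Icc.2 hxy.le))
  -- two candidates for `a`, at least one of which differs from `p`
  rcases eq_or_ne ((2 * x + y) / 3) p with h | h
  · refine ⟨(x + 2 * y) / 3, (y - x) / 3, by linarith, ⟨by linarith [hx.1], by linarith [hy.2]⟩,
      by intro h'; linarith, fun u hu => hsub ?_⟩
    have := abs_le.1 hu
    constructor <;> linarith
  · refine ⟨(2 * x + y) / 3, (y - x) / 3, by linarith, ⟨by linarith [hx.1], by linarith [hy.2]⟩,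
      h, fun u hu => hsub ?_⟩
    have := abs_le.1 hu
    constructor <;> linarith

/-- A lower bound on all events of `m` gives a lower bound on the conditional probability. -/
lemma indicator_le_condExp {Ω : Type*} {m mΩ : MeasurableSpace Ω} (hm : m ≤ mΩ) {P : Measure Ω}
    [IsProbabilityMeasure P] {G A : Set Ω} (hG : MeasurableSet[m] G) (hA : MeasurableSet A) {δ : ℝ}
    (hδ : 0 ≤ δ)
    (h : ∀ E, MeasurableSet[m] E → E ⊆ G → ENNReal.ofReal δ * P E ≤ P (E ∩ A)) :
    ∀ᵐ ω ∂P, G.indicator (fun _ => δ) ω ≤ (P⟦A | m⟧) ω := by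
  refine ae_le_of_ae_le_trim (hm := hm) (ae_le_of_forall_setIntegral_le ?_ ?_ ?_)
  · exact ((integrable_const δ).indicator hG)
  · exact integrable_condExp.trim hm stronglyMeasurable_condExp
  intro s hs _
  rw [← setIntegral_trim hm stronglyMeasurable_condExp hs,
    ← setIntegral_trim hm (stronglyMeasurable_const.indicator hG) hs,
    setIntegral_condExp hm ((integrable_const (1 : ℝ)).indicator hA) hs,
    setIntegral_indicator (hm _ hG), setIntegral_indicator hA, setIntegral_const,
    setIntegral_const, smul_eq_mul, smul_eq_mul, mul_one]
  have h1 := h (s ∩ G) (MeasurableSet.inter hs hG) Set.inter_subset_right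
  have h2 : ENNReal.ofReal δ * P (s ∩ G) ≤ P (s ∩ A) :=
    h1.trans (measure_mono (Set.inter_subset_inter_left _ Set.inter_subset_left))
  have h3 := ENNReal.toReal_mono (measure_ne_top _ _) h2
  rw [ENNReal.toReal_mul, ENNReal.toReal_ofReal hδ] at h3
  rw [Measure.real, Measure.real, mul_comm]
  exact h3

lemma measure_pos_of_le_condExp {Ω : Type*} {m mΩ : MeasurableSpace Ω} (hm : m ≤ mΩ)
    {P : Measure Ω} [IsProbabilityMeasure P] {S A : Set Ω} (hS : MeasurableSet S) (hSpos : 0 < P S)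
    (hA : MeasurableSet A) {δ : ℝ} (hδ : 0 < δ)
    (h : ∀ᵐ ω ∂P, δ * S.indicator (fun _ => (1 : ℝ)) ω ≤ (P⟦A | m⟧) ω) : 0 < P A := by
  have h1 := integral_mono_ae (((integrable_const (1 : ℝ)).indicator hS).const_mul δ)
    integrable_condExp h
  rw [integral_condExp hm, integral_const_mul, integral_indicator hS, integral_indicator hA,
    setIntegral_const, setIntegral_const, smul_eq_mul, smul_eq_mul, mul_one, mul_one] at h1
  have h2 : 0 < δ * P.real S :=
    mul_pos hδ (ENNReal.toReal_pos hSpos.ne' (measure_ne_top _ _))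
  exact (ENNReal.toReal_pos_iff.1 (h2.trans_le h1)).1

/-- The conditional lower bound on the law of the limit, given the initial configuration. -/
theorem exists_pos_le_condExp.{w} (hn : 2 ≤ n) {ρ : ℝ} (hρ : 0 < ρ) {I : Set ℝ}
    (hI : I.OrdConnected) (hI1 : I ⊆ Set.Icc (0 : ℝ) 1) (hvol : 0 < volume I) :
    ∃ δ : ℝ, 0 < δ ∧ ∀ (Ω : Type w) [MeasurableSpace Ω] (P : Measure Ω) [IsProbabilityMeasure P]
      (X : ℕ → Ω → Fin (n + 1) → ℝ) (U : ℕ → Ω → ℝ), IsProcess P X U →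
      ∀ ξ : Ω → ℝ, IsCoreLimit P X ξ →
        ∀ᵐ ω ∂P, δ * (separated X ρ).indicator (fun _ => (1 : ℝ)) ω ≤
          (P⟦ξ ⁻¹' I | MeasurableSpace.comap (X 0) inferInstance⟧) ω := by
  have hgrid : ∀ k : ℕ, ∃ δ : ℝ, 0 < δ ∧ (k * (ρ / 8) ∈ Set.Ioo (0 : ℝ) 1 →
      ∀ (Ω : Type w) [MeasurableSpace Ω] (P : Measure Ω) [IsProbabilityMeasure P]
      (X : ℕ → Ω → Fin (n + 1) → ℝ) (U : ℕ → Ω → ℝ), IsProcess P X U →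
      ∀ ξ : Ω → ℝ, IsCoreLimit P X ξ → ∀ E : Set Ω, MeasurableSet[history X 0] E →
        (∀ ω ∈ E, HasMedianGap (k * (ρ / 8)) (ρ / 4) (X 0 ω)) →
        ENNReal.ofReal δ * P E ≤ P (E ∩ ξ ⁻¹' I)) := by
    intro k
    by_cases hk : k * (ρ / 8) ∈ Set.Ioo (0 : ℝ) 1
    · obtain ⟨a, ε, hε, ha, hap, hsub⟩ := exists_near_subset hI hI1 hvol (k * (ρ / 8))
      obtain ⟨δ, hδ, H⟩ := exists_pos_le_measure_limit_near hn (show 0 < ρ / 4 by positivity) hε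
        hk ha hap
      refine ⟨δ, hδ, fun _ Ω _ P _ X U h ξ hξ E hE hgap => (H Ω P X U h ξ hξ E hE hgap).trans
        (measure_mono (Set.inter_subset_inter_right _ fun ω hω => hsub _ hω))⟩
    · exact ⟨1, one_pos, fun h => absurd h hk⟩
  choose δ hδ H using hgrid
  obtain ⟨δ₀, hδ₀, hmin⟩ : ∃ δ₀ : ℝ, 0 < δ₀ ∧ ∀ k < ⌈8 / ρ⌉₊, δ₀ ≤ δ k := by
    have hne : (Finset.range (⌈8 / ρ⌉₊ + 1)).Nonempty := ⟨0, by simp⟩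
    obtain ⟨k, -, hk⟩ := Finset.exists_min_image _ δ hne
    exact ⟨δ k, hδ k, fun j hj => hk j (by simp; omega)⟩
  refine ⟨δ₀, hδ₀, fun Ω _ P _ X U h ξ hξ => ?_⟩
  have hm : MeasurableSpace.comap (X 0) inferInstance ≤ ‹MeasurableSpace Ω› :=
    (h.measurable_config 0).comap_le
  have hIm : MeasurableSet (ξ ⁻¹' I) := hξ.1 hI.measurableSet
  have hall : ∀ k : ℕ, k * (ρ / 8) ∈ Set.Ioo (0 : ℝ) 1 → ∀ᵐ ω ∂P,
      (X 0 ⁻¹' {x | HasMedianGap (k * (ρ / 8)) (ρ / 4) x}).indicator (fun _ => δ k) ω ≤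
        (P⟦ξ ⁻¹' I | MeasurableSpace.comap (X 0) inferInstance⟧) ω := fun k hk =>
    indicator_le_condExp hm ⟨_, measurableSet_hasMedianGap _ _, rfl⟩ hIm (hδ k).le
      fun E hE hEG => H k hk Ω P X U h ξ hξ E (comap_zero_le_history _ hE) hEG
  have hnonneg : ∀ᵐ ω ∂P, 0 ≤ (P⟦ξ ⁻¹' I | MeasurableSpace.comap (X 0) inferInstance⟧) ω :=
    condExp_nonneg (ae_of_all _ fun ω => Set.indicator_nonneg (fun _ _ => zero_le_one) ω)
  filter_upwards [ae_all_iff.2 fun k => ae_all_iff.2 (hall k), hnonneg, h.initial_mem]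
    with ω h1 h2 h3
  by_cases hω : ω ∈ separated X ρ
  · rw [Set.indicator_of_mem hω, mul_one]
    have hsp : ρ ≤ minSpacing (X 0 ω) := hω
    obtain ⟨k, hk, hk01, hgap⟩ := exists_hasMedianGap hn hρ (x := X 0 ω)
      (fun i => mem_Icc_of_le_minSpacing hsp (h3 _))
      (fun i j hij => le_abs_sub_of_le_minSpacing hsp (by simpa using hij))
    have := h1 k hk01
    rw [Set.indicator_of_mem
      (show ω ∈ X 0 ⁻¹' {x | HasMedianGap (k * (ρ / 8)) (ρ / 4) x} from hgap)] at this
    exact (hmin k hk).trans this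
  · rw [Set.indicator_of_notMem hω, mul_zero]
    exact h2

/-! ### Independent uniform initial points and the support of the limit -/

section UniformStart
variable {N : ℕ} {Ω : Type*} [MeasurableSpace Ω] {P : Measure Ω}
  {X : ℕ → Ω → Fin N → ℝ} {U : ℕ → Ω → ℝ}

lemma measurable_minSpacing : Measurable (minSpacing (N := N)) := by
  have hw : ∀ a, Measurable fun x : Fin N → ℝ => withEndpoints x a := by
    intro a
    induction a using Fin.cases with
    | zero => exact measurable_const
    | succ a =>
      induction a using Fin.lastCases with
      | last => simp only [Fin.succ_last, withEndpoints_last]; exact measurable_const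
      | cast j => simp only [withEndpoints_succ_castSucc]; exact measurable_pi_apply j
  exact Measurable.iInf fun p => ((hw _).sub (hw _)).abs

lemma measurableSet_separated (hX : Measurable (X 0)) (ρ : ℝ) : MeasurableSet (separated X ρ) :=
  measurableSet_le measurable_const (measurable_minSpacing.comp hX)

/-- Independent uniform points are separated with positive probability: the `i`-th one may be near
`(i + 1) / (N + 1)`, for each `i`. -/
lemma IsUniformStart.measure_separated_pos (h : IsUniformStart P X) :
    0 < P (separated X (1 / (2 * (N + 1)))) := by
  obtain ⟨Y, hY, hind, hlaw, hord⟩ := h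
  set q : ℝ := 1 / (N + 1) with hq
  have hN : (0 : ℝ) < N + 1 := by positivity
  have hq0 : 0 < q := by positivity
  have hqN : (N + 1) * q = 1 := by rw [hq]; field_simp
  set B : Fin N → Set ℝ := fun i => {u | |u - (i + 1) * q| ≤ q / 4} with hB
  have hBm : ∀ i, MeasurableSet (B i) := fun i =>
    measurableSet_le (measurable_id.sub_const _).abs measurable_const
  have hi : ∀ i : Fin N, ((i : ℝ) + 1) ≤ N := fun i => by exact_mod_cast i.2
  have hpos : 0 < P (⋂ i ∈ Finset.univ, Y i ⁻¹' B i) := by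
    rw [hind.measure_inter_preimage_eq_mul Finset.univ fun i _ => hBm i]
    refine pos_iff_ne_zero.2 (Finset.prod_ne_zero_iff.2 fun i _ => ?_)
    rw [← Measure.map_apply (hY i) (hBm i), hlaw, Measure.restrict_apply (hBm i)]
    refine (volume_near_inter_pos ⟨by positivity, ?_⟩ (by positivity)).ne'
    nlinarith [hi i]
  refine hpos.trans_le (measure_mono_ae ?_)
  filter_upwards [hord] with ω hω hωB
  obtain ⟨⟨σ, hσ⟩, -⟩ := hω
  have hωB : ω ∈ ⋂ i ∈ Finset.univ, Y i ⁻¹' B i := hωB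
  simp only [Finset.mem_univ, Set.iInter_true, Set.mem_iInter, Set.mem_preimage] at hωB
  have hω' : ∀ i : Fin N, |Y i ω - (i + 1) * q| ≤ q / 4 := hωB
  have hhalf : 1 / (2 * ((N : ℝ) + 1)) = q / 2 := by rw [hq]; field_simp
  change _ ≤ minSpacing (X 0 ω)
  rw [hhalf, hσ]
  refine le_minSpacing ?_ (fun i => ?_) fun i j hij => ?_
  · nlinarith [(Nat.cast_nonneg N : (0 : ℝ) ≤ N)]
  · have h1 := abs_le.1 (hω' (σ i))
    have h2 := hi (σ i)
    have h3 : 0 ≤ ((σ i : ℕ) : ℝ) * q := by positivity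
    constructor
    · simp only [Function.comp_apply]; linarith
    · simp only [Function.comp_apply]; nlinarith
  · have hne : σ i ≠ σ j := fun e => hij (σ.injective e)
    simp only [Function.comp_apply]
    generalize σ i = a at hne
    generalize σ j = b at hne
    have h1 := abs_le.1 (hω' a)
    have h2 := abs_le.1 (hω' b)
    rcases lt_or_gt_of_ne hne with hab | hab
    · have : (a : ℝ) + 1 ≤ b := by exact_mod_cast hab
      rw [abs_sub_comm]
      refine le_trans ?_ (le_abs_self _)
      nlinarith
    · have : (b : ℝ) + 1 ≤ a := by exact_mod_cast hab
      refine le_trans ?_ (le_abs_self _)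
      nlinarith

/-- If `ξ` lies in `[0,1]` and meets every nontrivial interval with positive probability, then its
law has support `[0,1]`. -/
lemma support_map_eq_Icc {ξ : Ω → ℝ} (hξ : Measurable ξ)
    (hmem : ∀ᵐ ω ∂P, ξ ω ∈ Set.Icc (0 : ℝ) 1)
    (hpos : ∀ I : Set ℝ, I.OrdConnected → I ⊆ Set.Icc (0 : ℝ) 1 → 0 < volume I →
      0 < P (ξ ⁻¹' I)) : (P.map ξ).support = Set.Icc (0 : ℝ) 1 := by
  apply Set.Subset.antisymm
  · refine Measure.support_subset_of_isClosed isClosed_Icc ?_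
    rw [mem_ae_iff, Measure.map_apply hξ measurableSet_Icc.compl]
    exact hmem
  · intro x hx
    rw [Measure.mem_support_iff_forall]
    intro V hV
    obtain ⟨r, hr, hrV⟩ := Metric.mem_nhds_iff.1 hV
    set J := Set.Icc (0 : ℝ) 1 ∩ Set.Ioo (x - r) (x + r) with hJ
    have hJvol : 0 < volume J := by
      have hsub : Set.Ioo (max 0 (x - r)) (min 1 (x + r)) ⊆ J := fun u hu =>
        ⟨⟨(max_lt_iff.1 hu.1).1.le, (lt_min_iff.1 hu.2).1.le⟩,
          ⟨(max_lt_iff.1 hu.1).2, (lt_min_iff.1 hu.2).2⟩⟩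
      refine lt_of_lt_of_le ?_ (measure_mono hsub)
      rw [Real.volume_Ioo, ENNReal.ofReal_pos, sub_pos, max_lt_iff, lt_min_iff, lt_min_iff]
      exact ⟨⟨one_pos, by linarith [hx.1]⟩, by linarith [hx.2], by linarith⟩
    have h1 := hpos J (Set.ordConnected_Icc.inter Set.ordConnected_Ioo) Set.inter_subset_left hJvol
    rw [← Measure.map_apply hξ (measurableSet_Icc.inter measurableSet_Ioo)] at h1
    refine h1.trans_le (measure_mono fun u hu => hrV ?_)
    rw [Real.ball_eq_Ioo]
    exact hu.2

end UniformStart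

lemma IsCoreLimit.ae_mem_Icc {Ω : Type*} [MeasurableSpace Ω] {P : Measure Ω}
    {X : ℕ → Ω → Fin (n + 1) → ℝ} {U : ℕ → Ω → ℝ} {ξ : Ω → ℝ} (hn : n ≠ 0)
    (hξ : IsCoreLimit P X ξ) (h : IsProcess P X U) : ∀ᵐ ω ∂P, ξ ω ∈ Set.Icc (0 : ℝ) 1 := by
  filter_upwards [hξ.ae_tendsto_coreMean hn, h.ae_core_mem] with ω h1 h2
  exact isClosed_Icc.mem_of_tendsto h1 (Eventually.of_forall fun t => coreMean_mem_Icc hn (h2 t))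

end

end BeautyContest

theorem mainTheorem3 (N : ℕ) (hN : 3 ≤ N) :
    -- the limit of the core exists, so that the claims below are about an actual object
    (∀ (Ω : Type*) [MeasurableSpace Ω] (P : Measure Ω) [IsProbabilityMeasure P]
      (X : ℕ → Ω → Fin N → ℝ) (U : ℕ → Ω → ℝ), BeautyContest.IsProcess P X U →
      ∃ ξ : Ω → ℝ, (∀ ω, ξ ω ∈ Set.Icc (0 : ℝ) 1) ∧ BeautyContest.IsCoreLimit P X ξ) ∧
    -- the conditional lower bound, with `δ` depending only on `N`, `I` and `ρ`
    (∀ ρ : ℝ, 0 < ρ → ρ < 1 → ∀ I : Set ℝ, I.OrdConnected → I ⊆ Set.Icc (0 : ℝ) 1 →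
      0 < volume I → ∃ δ : ℝ, 0 < δ ∧
        ∀ (Ω : Type*) [MeasurableSpace Ω] (P : Measure Ω) [IsProbabilityMeasure P]
          (X : ℕ → Ω → Fin N → ℝ) (U : ℕ → Ω → ℝ), BeautyContest.IsProcess P X U →
          ∀ ξ : Ω → ℝ, BeautyContest.IsCoreLimit P X ξ →
            ∀ᵐ ω ∂P, δ * (BeautyContest.separated X ρ).indicator (fun _ => (1 : ℝ)) ω ≤
              (P⟦ξ ⁻¹' I | MeasurableSpace.comap (X 0) inferInstance⟧) ω) ∧
    -- the case of independent uniform initial points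
    (∀ (Ω : Type*) [MeasurableSpace Ω] (P : Measure Ω) [IsProbabilityMeasure P]
      (X : ℕ → Ω → Fin N → ℝ) (U : ℕ → Ω → ℝ), BeautyContest.IsProcess P X U →
      BeautyContest.IsUniformStart P X →
      ∀ ξ : Ω → ℝ, BeautyContest.IsCoreLimit P X ξ →
        (∀ I : Set ℝ, I.OrdConnected → I ⊆ Set.Icc (0 : ℝ) 1 → 0 < volume I →
          0 < P (ξ ⁻¹' I)) ∧
        (P.map ξ).support = Set.Icc (0 : ℝ) 1) := by
  obtain ⟨n, rfl⟩ : ∃ n, N = n + 1 := ⟨N - 1, by omega⟩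
  have hn : 2 ≤ n := by omega
  refine ⟨fun Ω _ P _ X U h => h.exists_isCoreLimit hn, fun ρ hρ _ I hI hI1 hvol =>
    BeautyContest.exists_pos_le_condExp hn hρ hI hI1 hvol, fun Ω _ P _ X U h hstart ξ hξ => ?_⟩
  have hpos : ∀ I : Set ℝ, I.OrdConnected → I ⊆ Set.Icc (0 : ℝ) 1 → 0 < volume I →
      0 < P (ξ ⁻¹' I) := by
    intro I hI hI1 hvol
    obtain ⟨δ, hδ, H⟩ := BeautyContest.exists_pos_le_condExp hn
      (ρ := 1 / (2 * ((n + 1 : ℕ) + 1))) (by positivity) hI hI1 hvol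
    exact BeautyContest.measure_pos_of_le_condExp (h.measurable_config 0).comap_le
      (BeautyContest.measurableSet_separated (h.measurable_config 0) _)
      hstart.measure_separated_pos (hξ.1 hI.measurableSet) hδ (H Ω P X U h ξ hξ)
  exact ⟨hpos, BeautyContest.support_map_eq_Icc hξ.1 (hξ.ae_mem_Icc (by omega) h) hpos⟩
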